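/- Let $n \ge 2$ and let $E_n^2 = \{0,1,\dots,n-1\}^2$. Let $\mathfrak{T}(2,n,*)$ be the class of all functions $f : E_n^2 \to \{0,1\}$ for which there exist an integer $k \ge 1$ and real numbers $a_{i0}, a_{i1}, a_{i2}$ ($i = 1,\dots,k$) such that $$\{x \in E_n^2 : f(x) = 1\} = \{x \in E_n^2 : a_{i1}x_1 + a_{i2}x_2 \le a_{i0} \text{ for } i = 1,\dots,k\}.$$ For $f \in \mathfrak{T}(2,n,*)$ let $P(f) \subset \mathbb{R}^2$ be the convex hull of $\{x \in E_n^2 : f(x) = 1\}$, and let $S(f, \mathfrak{T}(2,n,*))$ be the set of essential points of $f$, that is, of the points $x \in E_n^2$ for which there exists $g \in \mathfrak{T}(2,n,*)$ such that $g(x) \ne f(x)$ and $g(y) = f(y)$ for all $y \in E_n^2 \setminus \{x\}$. When $P(f)$ has positive area, so that it is a convex polygon, let $\mathcal{P}(P(f))$ be its perimeter and $q_{\min}(P(f))$ the minimum angle (in radians) between neighbouring edges of $P(f)$. **Theorem.** There is an absolute constant $C > 0$ such that for every $n \ge 2$ and every $f \in \mathfrak{T}(2,n,*)$ for which $P(f)$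 has positive area, $$\left|S(f, \mathfrak{T}(2,n,*))\right| \le C \cdot \min\left(n,\ \mathcal{P}(P(f)) + \frac{1}{q_{\min}(P(f))}\right).$$ -/

import Mathlib

namespace KThreshold

/-- The integer cube `{0, 1, …, n - 1} ^ d`. -/
abbrev Cube (d n : ℕ) : Type := Fin d → Fin n

/-- The set of points at which `f` takes the value `ν`. -/
def level {d n : ℕ} (ν : Bool) (f : Cube d n → Bool) : Set (Cube d n) := {x | f x = ν}

/-- The class of `k`-threshold functions: the set of ones is cut out of the cube by
`k` linear inequalities with real coefficients. -/
def thresholdClass (d n k : ℕ) : Set (Cube d n → Bool) :=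
  {f | ∃ (a : Fin k → Fin d → ℝ) (b : Fin k → ℝ),
    level true f = {x | ∀ i, ∑ j, a i j * ((x j : ℕ) : ℝ) ≤ b i}}

/-- The union of the classes of `k`-threshold functions over all `k ≥ 1`. -/
def thresholdClassAll (d n : ℕ) : Set (Cube d n → Bool) :=
  {f | ∃ k : ℕ, 1 ≤ k ∧ f ∈ thresholdClass d n k}

/-- The set of essential points of `f` with respect to the class `C`: the points `x` such that
some member of `C` differs from `f` at `x` and agrees with `f` at all other points. -/
def essentialPoints {X : Type*} (f : X → Bool) (C : Set (X → Bool)) : Set X :=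
  {x | ∃ g ∈ C, f x ≠ g x ∧ ∀ y, y ≠ x → f y = g y}

/-- A point of the integer cube as a point of Euclidean space. -/
noncomputable def toSpace {d n : ℕ} (x : Cube d n) : EuclideanSpace ℝ (Fin d) :=
  WithLp.toLp 2 fun j => ((x j : ℕ) : ℝ)

/-- `P(f)`: the convex hull of the set of ones of `f`. -/
def hull {d n : ℕ} (f : Cube d n → Bool) : Set (EuclideanSpace ℝ (Fin d)) :=
  convexHull ℝ (toSpace '' level true f)

/-- The points `u` and `v` are the two endpoints of an edge of `P`, that is, the segment `uv` is
nondegenerate and is the set of points of `P` at which some linear functional is maximal on `P`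
(so `u` and `v` are vertices of `P`). -/
def IsEdge (P : Set (EuclideanSpace ℝ (Fin 2))) (u v : EuclideanSpace ℝ (Fin 2)) : Prop :=
  u ≠ v ∧ IsExposed ℝ P (segment ℝ u v)

/-- The set of edges (as segments) of a convex polygon. -/
def edges (P : Set (EuclideanSpace ℝ (Fin 2))) : Set (Set (EuclideanSpace ℝ (Fin 2))) :=
  {e | ∃ u v, IsEdge P u v ∧ e = segment ℝ u v}

/-- The perimeter of a convex polygon: the sum of the lengths of its edges.  The length of a
segment is its diameter. -/
noncomputable def perimeter (P : Set (EuclideanSpace ℝ (Fin 2))) : ℝ :=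
  ∑ᶠ e ∈ edges P, Metric.diam e

/-- The set of angles of a convex polygon between neighbouring edges (two distinct edges `vu` and
`vw` with the common endpoint `v`). -/
def angles (P : Set (EuclideanSpace ℝ (Fin 2))) : Set ℝ :=
  {θ | ∃ u v w, IsEdge P v u ∧ IsEdge P v w ∧ u ≠ w ∧ θ = EuclideanGeometry.angle u v w}

/-- The minimum angle between neighbouring edges of a convex polygon (there are finitely many
angles, and at least one, so that the infimum is a minimum). -/
noncomputable def minAngle (P : Set (EuclideanSpace ℝ (Fin 2))) : ℝ := sInf (angles P)

end KThreshold

/-!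
Let `M` be the set of ones of `f`, as a set of lattice points of the plane. All combinatorial work
is done with integer determinants (`cross`) and scalar products (`dot`); the polygon `P(f)` enters
through its counterclockwise oriented edges `uv` (`IsBoundaryEdge`), which are found by turning a
ray about a point until it leaves `M` (`exists_turn`).

An essential one is separated from the other ones, so it is a vertex and an edge ends at it. An
essential zero `x` is separated from `M`, so it lies beyond some edge `uv`. As the convex hull of
`M ∪ {x}` contains no further lattice point, the triangle spanned by `x` and a primitive segment of
`uv` is unimodular, and `x` lies on the lattice line next to `uv` (`IsAddable.cross_eq`). If `x`
is also beyond one of the two neighbouring edges, it is the intersection of two such lines;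
otherwise it lies in the part of the line cut out by the extensions of these edges. Let `s` be the
number of lattice segments of `uv`. This part contains at most `s + 1 + cot α + cot β` lattice
points, where `α` and `β` are the angles at `u` and `v` and negative cotangents are replaced by
zero (`card_strip_le`), and also at most `n`, being on a line. Moreover `cot α ≤ 1 / α`, and a
cotangent is positive for at most four vertices, since each acute vertex is the only lowest,
highest, leftmost or rightmost point of `M` (`card_acute_le`).

Summing over all edges, the number of essential points is at most
`5 ∑ s + 8 min (n, 2 / q)`, where `q` is the minimum angle (`card_add_card_le`). Here `∑ s` is at
most the perimeter, as a primitive segment has length at least `1`, and at most `4 n`, as each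
lattice point of the boundary is extremal in its row or column (`sum_latticeLength_le`).
-/

namespace KThreshold

/-! ### Integer plane geometry -/

/-- The determinant of two integer vectors, positive when `b` is counterclockwise from `a`. -/
def cross (a b : ℤ × ℤ) : ℤ := a.1 * b.2 - a.2 * b.1

/-- The scalar product of two integer vectors. -/
def dot (a b : ℤ × ℤ) : ℤ := a.1 * b.1 + a.2 * b.2

theorem dot_self_pos {a : ℤ × ℤ} (h : a ≠ 0) : 0 < dot a a := by
  have : a.1 ≠ 0 ∨ a.2 ≠ 0 := by
    by_contra! hc
    exact h (Prod.ext hc.1 hc.2)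
  unfold dot
  rcases this with h | h
  · nlinarith [mul_self_pos.mpr h, mul_self_nonneg a.2]
  · nlinarith [mul_self_pos.mpr h, mul_self_nonneg a.1]

/-- If all points of `M` lie on one side of the line through `u` with direction `d` (`σ` is the
sign of the side), and those on the line lie in front of `u`, then turning this ray about `u` as
far as possible gives a ray through a point `w` of `M` with all of `M` on the near side. Of the
points on that ray the farthest (`κ = 1`) or the nearest one (`κ = -1`) is taken. -/
theorem exists_turn (M : Finset (ℤ × ℤ)) (u : ℤ × ℤ) (d₁ d₂ : ℝ) (σ : ℤ)
    (κ : ℤ)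
    (h : ∀ m ∈ M, 0 ≤ σ * (d₁ * (m.2 - u.2) - d₂ * (m.1 - u.1)) ∧
      (σ * (d₁ * (m.2 - u.2) - d₂ * (m.1 - u.1)) = 0 → 0 ≤ d₁ * (m.1 - u.1) + d₂ * (m.2 - u.2)))
    (hex : ∃ m ∈ M, 0 < σ * (d₁ * (m.2 - u.2) - d₂ * (m.1 - u.1))) :
    ∃ w ∈ M, 0 < σ * (d₁ * (w.2 - u.2) - d₂ * (w.1 - u.1)) ∧
      ∀ m ∈ M, 0 ≤ σ * cross (m - u) (w - u) ∧
        (cross (m - u) (w - u) = 0 → 0 ≤ dot (m - u) (w - u) ∧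
          (σ * (d₁ * (m.2 - u.2) - d₂ * (m.1 - u.1)) = 0 → dot (m - u) (w - u) = 0) ∧
          (0 < σ * (d₁ * (m.2 - u.2) - d₂ * (m.1 - u.1)) →
            κ * dot (m - u) (w - u) ≤ κ * dot (w - u) (w - u))) := by
  classical
  set D : ℤ × ℤ → ℝ := fun m => σ * (d₁ * (m.2 - u.2) - d₂ * (m.1 - u.1)) with hD
  set N : ℤ × ℤ → ℝ := fun m => d₁ * (m.1 - u.1) + d₂ * (m.2 - u.2) with hN
  change ∀ m ∈ M, 0 ≤ D m ∧ (D m = 0 → 0 ≤ N m) at h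
  have hcr : ∀ m w : ℤ × ℤ, N m * D w - N w * D m
      = (d₁ ^ 2 + d₂ ^ 2) * (σ * (cross (m - u) (w - u) : ℤ)) := by
    intro m w
    simp only [hD, hN, cross, Prod.fst_sub, Prod.snd_sub]
    push_cast
    ring
  have hdot : ∀ m w : ℤ × ℤ, (dot (m - u) (w - u) : ℝ) * D w
      = D m * dot (w - u) (w - u) + σ * N w * (cross (m - u) (w - u) : ℤ) := by
    intro m w
    simp only [hD, hN, cross, dot, Prod.fst_sub, Prod.snd_sub]
    push_cast
    ring
  have hdpos : 0 < d₁ ^ 2 + d₂ ^ 2 := by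
    obtain ⟨m, -, hm⟩ := hex
    by_contra hc
    have h1 : d₁ = 0 := by nlinarith [sq_nonneg d₁, sq_nonneg d₂]
    have h2 : d₂ = 0 := by nlinarith [sq_nonneg d₁, sq_nonneg d₂]
    simp [h1, h2] at hm
  -- minimize the cotangent of the angle between `d` and `m - u`
  obtain ⟨w₀, hw₀, hmin⟩ := (M.filter (fun m => 0 < D m)).exists_min_image (fun m => N m / D m)
    (by obtain ⟨m, hm, hm'⟩ := hex; exact ⟨m, Finset.mem_filter.2 ⟨hm, hm'⟩⟩)
  obtain ⟨hw₀M, hw₀D⟩ := Finset.mem_filter.1 hw₀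
  have side₀ : ∀ m ∈ M, 0 ≤ N m * D w₀ - N w₀ * D m := by
    intro m hm
    rcases (h m hm).1.lt_or_eq with h1 | h1
    · have := hmin m (Finset.mem_filter.2 ⟨hm, h1⟩)
      rw [div_le_div_iff₀ hw₀D h1] at this
      linarith
    · have := (h m hm).2 h1.symm
      rw [← h1]
      have := mul_nonneg this hw₀D.le
      linarith
  obtain ⟨w, hw, hmax⟩ := (M.filter (fun m => 0 < D m ∧ N m * D w₀ = N w₀ * D m)).exists_max_image
    (fun m => κ * D m) ⟨w₀, Finset.mem_filter.2 ⟨hw₀M, hw₀D, rfl⟩⟩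
  obtain ⟨hwM, hwD, hww₀⟩ := Finset.mem_filter.1 hw
  have hprop : ∀ m, (N m * D w - N w * D m) * D w₀ = (N m * D w₀ - N w₀ * D m) * D w := by
    intro m
    linear_combination -D m * hww₀
  have side : ∀ m ∈ M, 0 ≤ N m * D w - N w * D m := by
    intro m hm
    by_contra hc
    have h1 := mul_neg_of_neg_of_pos (not_le.1 hc) hw₀D
    rw [hprop] at h1
    have h2 := mul_nonneg (side₀ m hm) hwD.le
    linarith
  refine ⟨w, hwM, hwD, fun m hm => ⟨?_, fun hc => ?_⟩⟩
  · have h1 := side m hm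
    rw [hcr] at h1
    have := nonneg_of_mul_nonneg_right h1 hdpos
    exact_mod_cast this
  · have h2 := hdot m w
    rw [hc] at h2
    simp only [Int.cast_zero, mul_zero, add_zero] at h2
    have hww : (0 : ℝ) ≤ dot (w - u) (w - u) := by
      simp only [dot]
      push_cast
      nlinarith [mul_self_nonneg ((w - u).1 : ℝ), mul_self_nonneg ((w - u).2 : ℝ)]
    refine ⟨?_, fun h0 => ?_, fun h0 => ?_⟩
    · have h3 : (0 : ℝ) ≤ dot (m - u) (w - u) * D w := by
        rw [h2]; exact mul_nonneg (h m hm).1 hww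
      have := nonneg_of_mul_nonneg_left h3 hwD
      exact_mod_cast this
    · change D m = 0 at h0
      rw [h0, zero_mul] at h2
      rcases mul_eq_zero.1 h2 with h3 | h3
      · exact_mod_cast h3
      · exact absurd h3 hwD.ne'
    · have hmem : m ∈ M.filter (fun m => 0 < D m ∧ N m * D w₀ = N w₀ * D m) := by
        refine Finset.mem_filter.2 ⟨hm, h0, ?_⟩
        have h4 := hprop m
        rw [hcr m w, hc] at h4
        simp only [Int.cast_zero, mul_zero, zero_mul] at h4
        rcases mul_eq_zero.1 h4.symm with h5 | h5
        · linarith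
        · exact absurd h5 hwD.ne'
      have h3 := hmax m hmem
      have h4 : (κ : ℝ) * dot (m - u) (w - u) * D w ≤ κ * dot (w - u) (w - u) * D w := by
        rw [mul_assoc, h2]
        nlinarith [mul_le_mul_of_nonneg_right h3 hww]
      have := le_of_mul_le_mul_right h4 hwD
      exact_mod_cast this

/-! ### Oriented boundary edges of a finite set of lattice points -/

/-- The segment `uv` is an edge of the convex hull of `M`, oriented counterclockwise: `M` lies in
the closed half-plane to the left of the line `uv`, and the points of `M` on this line lie
between `u` and `v`. -/
structure IsBoundaryEdge (M : Finset (ℤ × ℤ)) (u v : ℤ × ℤ) : Prop where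
  left_mem : u ∈ M
  right_mem : v ∈ M
  ne : u ≠ v
  nonneg : ∀ m ∈ M, 0 ≤ cross (v - u) (m - u)
  dot_nonneg : ∀ m ∈ M, cross (v - u) (m - u) = 0 → 0 ≤ dot (v - u) (m - u)
  dot_le : ∀ m ∈ M, cross (v - u) (m - u) = 0 → dot (v - u) (m - u) ≤ dot (v - u) (v - u)

/-- The set `M` is not contained in a line. -/
def Spans (M : Finset (ℤ × ℤ)) : Prop :=
  ∀ u d : ℤ × ℤ, d ≠ 0 → ∃ m ∈ M, cross d (m - u) ≠ 0

/-- The point `y` is strictly separated from `M` by a line. -/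
def IsSeparated (M : Finset (ℤ × ℤ)) (y : ℤ × ℤ) : Prop :=
  ∃ a₁ a₂ : ℝ, ∀ m ∈ M, a₁ * m.1 + a₂ * m.2 < a₁ * y.1 + a₂ * y.2

theorem Spans.nonempty {M : Finset (ℤ × ℤ)} (h : Spans M) : M.Nonempty := by
  obtain ⟨m, hm, -⟩ := h 0 (1, 0) (by simp)
  exact ⟨m, hm⟩

section

variable {M : Finset (ℤ × ℤ)} {u v w z x : ℤ × ℤ}

theorem IsBoundaryEdge.sub_ne_zero (h : IsBoundaryEdge M u v) : v - u ≠ 0 :=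
  _root_.sub_ne_zero.2 h.ne.symm

/-- If a ray turned counterclockwise about `u` last meets `M` at `w`, then `wu` is an edge. -/
theorem IsBoundaryEdge.of_turn (hu : u ∈ M) (hwM : w ∈ M) (hwu : w ≠ u)
    (h : ∀ m ∈ M, m ≠ u → 0 ≤ cross (m - u) (w - u) ∧ (cross (m - u) (w - u) = 0 →
      0 ≤ dot (m - u) (w - u) ∧ dot (m - u) (w - u) ≤ dot (w - u) (w - u))) :
    IsBoundaryEdge M w u := by
  have h1 : ∀ m, cross (u - w) (m - w) = cross (m - u) (w - u) := by
    intro m; simp only [cross, Prod.fst_sub, Prod.snd_sub]; ring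
  have h2 : ∀ m, dot (u - w) (m - w) = dot (w - u) (w - u) - dot (m - u) (w - u) := by
    intro m; simp only [dot, Prod.fst_sub, Prod.snd_sub]; ring
  have h3 : dot (u - w) (u - w) = dot (w - u) (w - u) := by
    simp only [dot, Prod.fst_sub, Prod.snd_sub]; ring
  have h4 := dot_self_pos (_root_.sub_ne_zero.2 hwu)
  have h' : ∀ m ∈ M, 0 ≤ cross (m - u) (w - u) ∧ (cross (m - u) (w - u) = 0 →
      0 ≤ dot (m - u) (w - u) ∧ dot (m - u) (w - u) ≤ dot (w - u) (w - u)) := by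
    intro m hm
    by_cases hmu : m = u
    · subst hmu
      simp only [sub_self]
      refine ⟨by simp [cross], fun _ => ⟨by simp [dot], ?_⟩⟩
      simp only [dot, Prod.fst_zero, Prod.snd_zero, zero_mul, add_zero]
      exact h4.le
    · exact h m hm hmu
  refine ⟨hwM, hu, hwu, fun m hm => ?_, fun m hm hc => ?_, fun m hm hc => ?_⟩
  · rw [h1]; exact (h' m hm).1
  · rw [h1] at hc; rw [h2]; linarith [((h' m hm).2 hc).2]
  · rw [h1] at hc; rw [h2, h3]; linarith [((h' m hm).2 hc).1]

/-- If a ray turned clockwise about `u` last meets `M` at `w`, then `uw` is an edge. -/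
theorem IsBoundaryEdge.of_turn_neg (hu : u ∈ M) (hwM : w ∈ M) (hwu : w ≠ u)
    (h : ∀ m ∈ M, m ≠ u → 0 ≤ - cross (m - u) (w - u) ∧ (cross (m - u) (w - u) = 0 →
      0 ≤ dot (m - u) (w - u) ∧ dot (m - u) (w - u) ≤ dot (w - u) (w - u))) :
    IsBoundaryEdge M u w := by
  have h1 : ∀ m, cross (w - u) (m - u) = - cross (m - u) (w - u) := by
    intro m; simp only [cross]; ring
  have h2 : ∀ m, dot (w - u) (m - u) = dot (m - u) (w - u) := by
    intro m; simp only [dot]; ring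
  have h4 := dot_self_pos (_root_.sub_ne_zero.2 hwu)
  have h' : ∀ m ∈ M, 0 ≤ - cross (m - u) (w - u) ∧ (cross (m - u) (w - u) = 0 →
      0 ≤ dot (m - u) (w - u) ∧ dot (m - u) (w - u) ≤ dot (w - u) (w - u)) := by
    intro m hm
    by_cases hmu : m = u
    · subst hmu
      simp only [sub_self]
      refine ⟨by simp [cross], fun _ => ⟨by simp [dot], ?_⟩⟩
      simp only [dot, Prod.fst_zero, Prod.snd_zero, zero_mul, add_zero]
      exact h4.le
    · exact h m hm hmu
  refine ⟨hu, hwM, hwu.symm, fun m hm => ?_, fun m hm hc => ?_, fun m hm hc => ?_⟩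
  · rw [h1]; exact (h' m hm).1
  · rw [h1, neg_eq_zero] at hc; rw [h2]; exact ((h' m hm).2 hc).1
  · rw [h1, neg_eq_zero] at hc; rw [h2]; exact ((h' m hm).2 hc).2

/-- If `M` lies to the left of the line through `u ∈ M` with direction `d`, not entirely on it,
and the points on the line lie in front of `u`, then some edge ends at `u`. -/
theorem exists_edge_to (hu : u ∈ M) (d : ℤ × ℤ)
    (h : ∀ m ∈ M, 0 ≤ cross d (m - u) ∧ (cross d (m - u) = 0 → 0 ≤ dot d (m - u)))
    (hex : ∃ m ∈ M, 0 < cross d (m - u)) :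
    ∃ w, IsBoundaryEdge M w u ∧ 0 < cross d (w - u) := by
  have hc : ∀ m : ℤ × ℤ, ((1 : ℤ) : ℝ) * (d.1 * (m.2 - u.2) - d.2 * (m.1 - u.1))
      = (cross d (m - u) : ℤ) := by
    intro m; simp only [cross, Prod.fst_sub, Prod.snd_sub]; push_cast; ring
  have hd : ∀ m : ℤ × ℤ, ((d.1 : ℝ) * (m.1 - u.1) + d.2 * (m.2 - u.2))
      = (dot d (m - u) : ℤ) := by
    intro m; simp only [dot, Prod.fst_sub, Prod.snd_sub]; push_cast; ring
  obtain ⟨w, hwM, hw0, hw⟩ := exists_turn M u d.1 d.2 1 1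
    (by simp only [hc, hd]; exact_mod_cast h) (by simp only [hc]; exact_mod_cast hex)
  simp only [hc] at hw0 hw
  have hw0 : 0 < cross d (w - u) := by exact_mod_cast hw0
  refine ⟨w, IsBoundaryEdge.of_turn hu hwM ?_ fun m hm hmu => ?_, hw0⟩
  · rintro rfl; simp [cross] at hw0
  · obtain ⟨h1, h2⟩ := hw m hm
    refine ⟨by linarith, fun h0 => ⟨(h2 h0).1, ?_⟩⟩
    rcases (h m hm).1.lt_or_eq with h3 | h3
    · have := (h2 h0).2.2 (by exact_mod_cast h3); linarith
    · rw [(h2 h0).2.1 (by exact_mod_cast h3.symm)]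
      unfold dot; nlinarith [mul_self_nonneg (w - u).1, mul_self_nonneg (w - u).2]

/-- The mirror image of `exists_edge_to`. -/
theorem exists_edge_from (hu : u ∈ M) (d : ℤ × ℤ)
    (h : ∀ m ∈ M, 0 ≤ - cross d (m - u) ∧ (cross d (m - u) = 0 → 0 ≤ dot d (m - u)))
    (hex : ∃ m ∈ M, 0 < - cross d (m - u)) :
    ∃ w, IsBoundaryEdge M u w ∧ 0 < - cross d (w - u) := by
  have hc : ∀ m : ℤ × ℤ, ((-1 : ℤ) : ℝ) * (d.1 * (m.2 - u.2) - d.2 * (m.1 - u.1))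
      = (- cross d (m - u) : ℤ) := by
    intro m; simp only [cross, Prod.fst_sub, Prod.snd_sub]; push_cast; ring
  have hd : ∀ m : ℤ × ℤ, ((d.1 : ℝ) * (m.1 - u.1) + d.2 * (m.2 - u.2))
      = (dot d (m - u) : ℤ) := by
    intro m; simp only [dot, Prod.fst_sub, Prod.snd_sub]; push_cast; ring
  obtain ⟨w, hwM, hw0, hw⟩ := exists_turn M u d.1 d.2 (-1) 1
    (by
      intro m hm
      rw [hc, hd]
      refine ⟨by exact_mod_cast (h m hm).1, fun h0 => ?_⟩
      exact_mod_cast (h m hm).2 (neg_eq_zero.1 (by exact_mod_cast h0)))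
    (by simp only [hc]; exact_mod_cast hex)
  simp only [hc] at hw0 hw
  have hw0 : 0 < - cross d (w - u) := by exact_mod_cast hw0
  refine ⟨w, IsBoundaryEdge.of_turn_neg hu hwM ?_ fun m hm hmu => ?_, hw0⟩
  · rintro rfl; simp [cross] at hw0
  · obtain ⟨h1, h2⟩ := hw m hm
    refine ⟨by linarith, fun h0 => ⟨(h2 h0).1, ?_⟩⟩
    rcases (h m hm).1.lt_or_eq with h3 | h3
    · have := (h2 h0).2.2 (by exact_mod_cast h3); linarith
    · rw [(h2 h0).2.1 (by exact_mod_cast h3.symm)]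
      unfold dot; nlinarith [mul_self_nonneg (w - u).1, mul_self_nonneg (w - u).2]

theorem IsBoundaryEdge.exists_prev (hS : Spans M) (h : IsBoundaryEdge M u v) :
    ∃ w, IsBoundaryEdge M w u ∧ 0 < cross (v - u) (w - u) := by
  refine exists_edge_to h.left_mem (v - u) (fun m hm => ⟨h.nonneg m hm, h.dot_nonneg m hm⟩) ?_
  obtain ⟨m, hm, hm0⟩ := hS u (v - u) h.sub_ne_zero
  exact ⟨m, hm, lt_of_le_of_ne (h.nonneg m hm) hm0.symm⟩

theorem IsBoundaryEdge.exists_next (hS : Spans M) (h : IsBoundaryEdge M u v) :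
    ∃ z, IsBoundaryEdge M v z ∧ 0 < cross (v - u) (z - v) := by
  have h1 : ∀ m, - cross (u - v) (m - v) = cross (v - u) (m - u) := by
    intro m; simp only [cross, Prod.fst_sub, Prod.snd_sub]; ring
  have h2 : ∀ m, dot (u - v) (m - v) = dot (v - u) (v - u) - dot (v - u) (m - u) := by
    intro m; simp only [dot, Prod.fst_sub, Prod.snd_sub]; ring
  have h3 : ∀ m, cross (v - u) (m - v) = cross (v - u) (m - u) := by
    intro m; simp only [cross, Prod.fst_sub, Prod.snd_sub]; ring
  obtain ⟨z, hz, hz0⟩ := exists_edge_from (M := M) h.right_mem (u - v) (fun m hm => by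
      rw [h1, h2]
      refine ⟨h.nonneg m hm, fun h0 => ?_⟩
      rw [← neg_eq_zero, h1] at h0
      linarith [h.dot_le m hm h0]) (by
      obtain ⟨m, hm, hm0⟩ := hS u (v - u) h.sub_ne_zero
      exact ⟨m, hm, by rw [h1]; exact lt_of_le_of_ne (h.nonneg m hm) hm0.symm⟩)
  exact ⟨z, hz, by rw [h3, ← h1]; exact hz0⟩

/-- A point of `M` separated from the others is a vertex, so some edge ends at it. -/
theorem exists_edge_of_isSeparated_erase (hS : Spans M) (hx : x ∈ M)
    (h : IsSeparated (M.erase x) x) : ∃ w, IsBoundaryEdge M w x := by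
  obtain ⟨a₁, a₂, ha⟩ := h
  have hpos : ∀ m ∈ M.erase x,
      0 < ((1 : ℤ) : ℝ) * (-a₂ * (m.2 - x.2) - a₁ * (m.1 - x.1)) := by
    intro m hm
    have := ha m hm
    push_cast
    linarith
  have hne : (M.erase x).Nonempty := by
    obtain ⟨m, hm, hm0⟩ := hS x (1, 0) (by simp)
    refine ⟨m, Finset.mem_erase.2 ⟨?_, hm⟩⟩
    rintro rfl
    simp [cross] at hm0
  obtain ⟨w, hwM, hw0, hw⟩ := exists_turn (M.erase x) x (-a₂) a₁ 1 1
    (fun m hm => ⟨(hpos m hm).le, fun h0 => absurd h0 (hpos m hm).ne'⟩)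
    (by obtain ⟨m, hm⟩ := hne; exact ⟨m, hm, hpos m hm⟩)
  refine ⟨w, IsBoundaryEdge.of_turn hx (Finset.mem_of_mem_erase hwM) (Finset.ne_of_mem_erase hwM)
    fun m hm hmx => ?_⟩
  have hm' := Finset.mem_erase.2 ⟨hmx, hm⟩
  obtain ⟨h1, h2⟩ := hw m hm'
  refine ⟨by linarith, fun h0 => ⟨(h2 h0).1, ?_⟩⟩
  have := (h2 h0).2.2 (hpos m hm')
  linarith

/-- A point separated from `M` lies strictly to the right of some edge: of the two edges at the
nearest tangent point `w`, the one that faces `x`. -/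
theorem exists_edge_of_isSeparated (hS : Spans M) (h : IsSeparated M x) :
    ∃ u v, IsBoundaryEdge M u v ∧ cross (v - u) (x - u) < 0 := by
  obtain ⟨a₁, a₂, ha⟩ := h
  have hpos : ∀ m ∈ M,
      0 < ((-1 : ℤ) : ℝ) * (a₂ * (m.2 - x.2) - (-a₁) * (m.1 - x.1)) := by
    intro m hm
    have := ha m hm
    push_cast
    linarith
  obtain ⟨w, hwM, hw0, hw⟩ := exists_turn M x a₂ (-a₁) (-1) (-1)
    (fun m hm => ⟨(hpos m hm).le, fun h0 => absurd h0 (hpos m hm).ne'⟩)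
    (by obtain ⟨m, hm⟩ := hS.nonempty; exact ⟨m, hm, hpos m hm⟩)
  have hwx : w - x ≠ 0 := by
    intro h0
    obtain rfl := _root_.sub_eq_zero.1 h0
    simp at hw0
  have h1 : ∀ m, cross (w - x) (m - w) = - cross (m - x) (w - x) := by
    intro m; simp only [cross, Prod.fst_sub, Prod.snd_sub]; ring
  have h2 : ∀ m, dot (w - x) (m - w) = dot (m - x) (w - x) - dot (w - x) (w - x) := by
    intro m; simp only [dot, Prod.fst_sub, Prod.snd_sub]; ring
  have hside : ∀ m ∈ M, 0 ≤ cross (w - x) (m - w) := by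
    intro m hm
    rw [h1]
    linarith [(hw m hm).1]
  obtain ⟨v, hv, hv0⟩ := exists_edge_to (M := M) hwM (w - x) (fun m hm => by
      refine ⟨hside m hm, fun h0 => ?_⟩
      rw [h1, neg_eq_zero] at h0
      rw [h2]
      linarith [((hw m hm).2 h0).2.2 (hpos m hm)]) (by
      obtain ⟨m, hm, hm0⟩ := hS w (w - x) hwx
      exact ⟨m, hm, lt_of_le_of_ne (hside m hm) hm0.symm⟩)
  refine ⟨v, w, hv, ?_⟩
  have : cross (w - v) (x - v) = - cross (w - x) (v - w) := by
    simp only [cross, Prod.fst_sub, Prod.snd_sub]; ring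
  linarith

/-- Vectors on the same ray, each projecting into the other, coincide. -/
theorem eq_of_parallel {a b : ℤ × ℤ} (ha : a ≠ 0) (hb : b ≠ 0) (hc : cross a b = 0)
    (h0 : 0 ≤ dot a b) (h1 : dot a b ≤ dot a a) (h2 : dot a b ≤ dot b b) : a = b := by
  have hL : dot a b * dot a b = dot a a * dot b b - cross a b * cross a b := by
    simp only [dot, cross]; ring
  rw [hc] at hL
  have pa := dot_self_pos ha
  have pb := dot_self_pos hb
  have e1 : dot a a ≤ dot a b := by
    by_contra! h
    nlinarith
  have e2 : dot b b ≤ dot a b := by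
    by_contra! h
    nlinarith
  by_contra hne
  have := dot_self_pos (_root_.sub_ne_zero.2 hne)
  have h3 : dot (a - b) (a - b) = dot a a + dot b b - 2 * dot a b := by
    simp only [dot, Prod.fst_sub, Prod.snd_sub]; ring
  linarith

theorem cross_swap (a b : ℤ × ℤ) : cross a b = - cross b a := by
  simp only [cross]; ring

theorem dot_swap (a b : ℤ × ℤ) : dot a b = dot b a := by
  simp only [dot]; ring

theorem IsBoundaryEdge.right_unique {v' : ℤ × ℤ} (h : IsBoundaryEdge M u v)
    (h' : IsBoundaryEdge M u v') : v = v' := by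
  have h1 := h.nonneg v' h'.right_mem
  have h2 := h'.nonneg v h.right_mem
  rw [cross_swap] at h2
  have h0 : cross (v - u) (v' - u) = 0 := by linarith
  have h0' : cross (v' - u) (v - u) = 0 := by rw [cross_swap, h0, neg_zero]
  have := eq_of_parallel h.sub_ne_zero h'.sub_ne_zero h0 (h.dot_nonneg v' h'.right_mem h0)
    (h.dot_le v' h'.right_mem h0)
    (by rw [dot_swap]; exact h'.dot_le v h.right_mem h0')
  exact sub_left_injective this

theorem IsBoundaryEdge.left_unique {u' : ℤ × ℤ} (h : IsBoundaryEdge M u v)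
    (h' : IsBoundaryEdge M u' v) : u = u' := by
  have k : ∀ a : ℤ × ℤ, ∀ b, cross (v - a) (b - a) = cross (b - v) (a - v) := by
    intro a b; simp only [cross, Prod.fst_sub, Prod.snd_sub]; ring
  have l : ∀ a : ℤ × ℤ, ∀ b, dot (v - a) (b - a) = dot (a - v) (a - v) - dot (a - v) (b - v) := by
    intro a b; simp only [dot, Prod.fst_sub, Prod.snd_sub]; ring
  have l' : ∀ a : ℤ × ℤ, dot (v - a) (v - a) = dot (a - v) (a - v) := by
    intro a; simp only [dot, Prod.fst_sub, Prod.snd_sub]; ring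
  have h1 := h.nonneg u' h'.left_mem
  have h2 := h'.nonneg u h.left_mem
  rw [k] at h1 h2
  have h0 : cross (u - v) (u' - v) = 0 := by
    rw [cross_swap] at h1; linarith
  have h0' : cross (u' - v) (u - v) = 0 := by rw [cross_swap, h0, neg_zero]
  have a1 := h.dot_nonneg u' h'.left_mem (by rw [k]; exact h0')
  have a2 := h.dot_le u' h'.left_mem (by rw [k]; exact h0')
  have a3 := h'.dot_nonneg u h.left_mem (by rw [k]; exact h0)
  rw [l] at a1 a2 a3
  rw [l'] at a2
  rw [dot_swap (u' - v) (u - v)] at a3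
  have := eq_of_parallel (_root_.sub_ne_zero.2 h.ne) (_root_.sub_ne_zero.2 h'.ne) h0
    (by linarith) (by linarith) (by linarith)
  exact sub_left_injective this

end

/-! ### Lattice lengths of edges -/

/-- The number of lattice segments into which lattice points divide the segment `uv`. -/
def latticeLength (u v : ℤ × ℤ) : ℕ := Int.gcd (v - u).1 (v - u).2

/-- The primitive lattice vector pointing from `u` to `v`. -/
def step (u v : ℤ × ℤ) : ℤ × ℤ := ((v - u).1 / latticeLength u v, (v - u).2 / latticeLength u v)

theorem latticeLength_pos {u v : ℤ × ℤ} (h : u ≠ v) : 0 < latticeLength u v := by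
  refine Nat.pos_of_ne_zero fun h0 => h ?_
  obtain ⟨h1, h2⟩ := Int.gcd_eq_zero_iff.1 h0
  exact (sub_eq_zero.1 (Prod.ext h1 h2 : v - u = 0)).symm

theorem sub_eq_smul_step (u v : ℤ × ℤ) : v - u = (latticeLength u v : ℤ) • step u v := by
  refine Prod.ext ?_ ?_
  · exact (Int.mul_ediv_cancel' (Int.gcd_dvd_left ..)).symm
  · exact (Int.mul_ediv_cancel' (Int.gcd_dvd_right ..)).symm

/-- Bézout's identity: `step u v` belongs to a basis of the lattice. -/
theorem exists_cross_step_eq_one {u v : ℤ × ℤ} (h : u ≠ v) : ∃ q, cross (step u v) q = 1 := by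
  have hs := latticeLength_pos h
  have h1 : Int.gcd (step u v).1 (step u v).2 = 1 := by
    exact Int.gcd_ediv_gcd_ediv_gcd (by unfold latticeLength at hs; exact hs)
  have h2 := Int.gcd_eq_gcd_ab (step u v).1 (step u v).2
  rw [h1] at h2
  refine ⟨(-Int.gcdB (step u v).1 (step u v).2, Int.gcdA (step u v).1 (step u v).2), ?_⟩
  simp only [cross]
  push_cast at h2
  linarith

theorem step_ne_zero {u v : ℤ × ℤ} (h : u ≠ v) : step u v ≠ 0 := by
  intro h0
  obtain ⟨q, hq⟩ := exists_cross_step_eq_one h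
  simp [h0, cross] at hq

theorem cross_sub_eq (u v a : ℤ × ℤ) :
    cross (v - u) a = latticeLength u v * cross (step u v) a := by
  rw [sub_eq_smul_step u v]
  simp only [cross, Prod.smul_fst, Prod.smul_snd, smul_eq_mul]
  ring

theorem dot_sub_eq (u v a : ℤ × ℤ) :
    dot (v - u) a = latticeLength u v * dot (step u v) a := by
  rw [sub_eq_smul_step u v]
  simp only [dot, Prod.smul_fst, Prod.smul_snd, smul_eq_mul]
  ring

theorem eq_cross_smul {p q : ℤ × ℤ} (h : cross p q = 1) (a : ℤ × ℤ) :
    a = cross a q • p + cross p a • q := by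
  refine Prod.ext ?_ ?_
  · simp only [cross, Prod.fst_add, Prod.smul_fst, smul_eq_mul] at h ⊢
    linear_combination -a.1 * h
  · simp only [cross, Prod.snd_add, Prod.smul_snd, smul_eq_mul] at h ⊢
    linear_combination -a.2 * h

/-- Parallel primitive vectors agree up to sign. -/
theorem eq_or_eq_neg_of_cross_eq_zero {p q p' q' : ℤ × ℤ} (h : cross p q = 1)
    (h' : cross p' q' = 1) (h0 : cross p p' = 0) : p' = p ∨ p' = -p := by
  have h1 := eq_cross_smul h p'
  rw [h0, zero_smul, add_zero] at h1
  rw [h1] at h'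
  have h2 : cross p' q * cross p q' = 1 := by
    rw [← h']; simp only [cross, Prod.smul_fst, Prod.smul_snd, smul_eq_mul]; ring
  rcases Int.eq_one_or_neg_one_of_mul_eq_one h2 with h3 | h3
  · left; rw [h1, h3, one_smul]
  · right; rw [h1, h3, neg_one_smul]

/-- The square `{0, …, n - 1} ^ 2`. -/
noncomputable def box (n : ℕ) : Finset (ℤ × ℤ) := Finset.Ico 0 (n : ℤ) ×ˢ Finset.Ico 0 (n : ℤ)

theorem mem_box {n : ℕ} {a : ℤ × ℤ} :
    a ∈ box n ↔ (0 ≤ a.1 ∧ a.1 < n) ∧ (0 ≤ a.2 ∧ a.2 < n) := by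
  simp [box]

theorem mem_box_of_convex {n : ℕ} {a b c y : ℤ × ℤ} {α β γ : ℤ} (hα : 0 ≤ α) (hβ : 0 ≤ β)
    (hγ : 0 ≤ γ) (hpos : 0 < α + β + γ) (ha : a ∈ box n) (hb : b ∈ box n) (hc : c ∈ box n)
    (h : (α + β + γ) • y = α • a + β • b + γ • c) : y ∈ box n := by
  rw [mem_box] at *
  have h1 := congrArg Prod.fst h
  have h2 := congrArg Prod.snd h
  simp only [Prod.smul_fst, Prod.smul_snd, Prod.fst_add, Prod.snd_add, smul_eq_mul] at h1 h2
  have key : ∀ a b c y : ℤ, (0 ≤ a ∧ a < n) → (0 ≤ b ∧ b < n) → (0 ≤ c ∧ c < n) →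
      (α + β + γ) * y = α * a + β * b + γ * c → 0 ≤ y ∧ y < n := by
    intro a b c y ha hb hc h
    constructor
    · refine nonneg_of_mul_nonneg_right ?_ hpos
      rw [h]
      have := mul_nonneg hα ha.1
      have := mul_nonneg hβ hb.1
      have := mul_nonneg hγ hc.1
      linarith
    · have h1 := mul_le_mul_of_nonneg_left (show a ≤ n - 1 by omega) hα
      have h2 := mul_le_mul_of_nonneg_left (show b ≤ n - 1 by omega) hβ
      have h3 := mul_le_mul_of_nonneg_left (show c ≤ n - 1 by omega) hγ
      have : (α + β + γ) * y ≤ (α + β + γ) * (n - 1) := by rw [h]; linarith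
      have := le_of_mul_le_mul_left this hpos
      omega
  exact ⟨key _ _ _ _ ha.1 hb.1 hc.1 h1, key _ _ _ _ ha.2 hb.2 hc.2 h2⟩

theorem not_isSeparated_of_convex {M : Finset (ℤ × ℤ)} {a b c y : ℤ × ℤ} {α β γ : ℤ} (hα : 0 ≤ α)
    (hβ : 0 ≤ β) (hγ : 0 ≤ γ) (hpos : 0 < α + β + γ) (ha : a ∈ M) (hb : b ∈ M) (hc : c ∈ M)
    (h : (α + β + γ) • y = α • a + β • b + γ • c) : ¬ IsSeparated M y := by
  rintro ⟨a₁, a₂, hs⟩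
  have h1 := congrArg (fun z : ℤ × ℤ => (z.1 : ℝ)) h
  have h2 := congrArg (fun z : ℤ × ℤ => (z.2 : ℝ)) h
  simp only [Prod.smul_fst, Prod.smul_snd, Prod.fst_add, Prod.snd_add, smul_eq_mul] at h1 h2
  push_cast at h1 h2
  have ea := hs a ha
  have eb := hs b hb
  have ec := hs c hc
  have hα' : (0 : ℝ) ≤ α := by exact_mod_cast hα
  have hβ' : (0 : ℝ) ≤ β := by exact_mod_cast hβ
  have hγ' : (0 : ℝ) ≤ γ := by exact_mod_cast hγ
  have hpos' : (0 : ℝ) < α + β + γ := by exact_mod_cast hpos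
  have e : (α : ℝ) * (a₁ * y.1 + a₂ * y.2 - (a₁ * a.1 + a₂ * a.2))
      + β * (a₁ * y.1 + a₂ * y.2 - (a₁ * b.1 + a₂ * b.2))
      + γ * (a₁ * y.1 + a₂ * y.2 - (a₁ * c.1 + a₂ * c.2)) = 0 := by
    linear_combination a₁ * h1 + a₂ * h2
  have f1 := mul_nonneg hα' (sub_pos.2 ea).le
  have f2 := mul_nonneg hβ' (sub_pos.2 eb).le
  have f3 := mul_nonneg hγ' (sub_pos.2 ec).le
  have g1 := (mul_eq_zero.1 (le_antisymm (by linarith) f1)).resolve_right (sub_pos.2 ea).ne'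
  have g2 := (mul_eq_zero.1 (le_antisymm (by linarith) f2)).resolve_right (sub_pos.2 eb).ne'
  have g3 := (mul_eq_zero.1 (le_antisymm (by linarith) f3)).resolve_right (sub_pos.2 ec).ne'
  linarith

section

variable {M : Finset (ℤ × ℤ)} {u v w z x u' v' : ℤ × ℤ}

theorem IsBoundaryEdge.step_nonneg (h : IsBoundaryEdge M u v) {m : ℤ × ℤ} (hm : m ∈ M) :
    0 ≤ cross (step u v) (m - u) := by
  have h1 := h.nonneg m hm
  rw [cross_sub_eq] at h1
  exact nonneg_of_mul_nonneg_right h1 (by exact_mod_cast latticeLength_pos h.ne)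

/-- The lattice points of the edge `u'v'` lie to the left of the edge `uv`. -/
theorem IsBoundaryEdge.step_nonneg_add (h : IsBoundaryEdge M u v) (h' : IsBoundaryEdge M u' v')
    {i : ℤ} (h0 : 0 ≤ i) (hi : i ≤ latticeLength u' v') :
    0 ≤ cross (step u v) (u' + i • step u' v' - u) := by
  have hs : (0 : ℤ) < latticeLength u' v' := by exact_mod_cast latticeLength_pos h'.ne
  have h1 := h.step_nonneg h'.left_mem
  have h2 := h.step_nonneg h'.right_mem
  have h3 : v' = u' + (latticeLength u' v' : ℤ) • step u' v' := by
    rw [← sub_eq_smul_step]; abel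
  rw [h3] at h2
  have h4 : (latticeLength u' v' : ℤ) * cross (step u v) (u' + i • step u' v' - u)
      = (latticeLength u' v' - i) * cross (step u v) (u' - u)
        + i * cross (step u v) (u' + (latticeLength u' v' : ℤ) • step u' v' - u) := by
    simp only [cross, Prod.fst_sub, Prod.snd_sub, Prod.fst_add, Prod.snd_add, Prod.smul_fst,
      Prod.smul_snd, smul_eq_mul]
    ring
  refine nonneg_of_mul_nonneg_right (a := (latticeLength u' v' : ℤ)) ?_ hs
  rw [h4]
  exact add_nonneg (mul_nonneg (by linarith) h1) (mul_nonneg h0 h2)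

/-- Two edges that are not oppositely directed and share a lattice point other than their final
ends `v` and `v'` coincide. -/
theorem IsBoundaryEdge.eq_of_common_point (h : IsBoundaryEdge M u v) (h' : IsBoundaryEdge M u' v')
    {i i' : ℤ} (hi : i < latticeLength u v)
    (hi' : i' < latticeLength u' v') (he : u + i • step u v = u' + i' • step u' v')
    (hdir : step u' v' ≠ - step u v) : u = u' ∧ v = v' ∧ i = i' := by
  have e1 : v = u + (latticeLength u v : ℤ) • step u v := by rw [← sub_eq_smul_step]; abel
  have e2 : v' = u' + (latticeLength u' v' : ℤ) • step u' v' := by rw [← sub_eq_smul_step]; abel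
  have hv : v = u' + i' • step u' v' + ((latticeLength u v : ℤ) - i) • step u v := by
    rw [← he, sub_smul]; nth_rw 1 [e1]; abel
  have hv' : v' = u + i • step u v + ((latticeLength u' v' : ℤ) - i') • step u' v' := by
    rw [he, sub_smul]; nth_rw 1 [e2]; abel
  have c1 := h.step_nonneg h'.right_mem
  have c2 := h'.step_nonneg h.right_mem
  have d1 : cross (step u v) (v' - u)
      = (latticeLength u' v' - i') * cross (step u v) (step u' v') := by
    nth_rw 1 [hv']
    simp only [cross, Prod.fst_sub, Prod.snd_sub, Prod.fst_add, Prod.snd_add, Prod.smul_fst,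
      Prod.smul_snd, smul_eq_mul]
    ring
  have d2 : cross (step u' v') (v - u')
      = - ((latticeLength u v - i) * cross (step u v) (step u' v')) := by
    nth_rw 1 [hv]
    simp only [cross, Prod.fst_sub, Prod.snd_sub, Prod.fst_add, Prod.snd_add, Prod.smul_fst,
      Prod.smul_snd, smul_eq_mul]
    ring
  rw [d1] at c1
  rw [d2] at c2
  have f1 := nonneg_of_mul_nonneg_right c1 (by linarith)
  have hcr : cross (step u v) (step u' v') = 0 := by
    by_contra hne
    have := mul_pos (show 0 < (latticeLength u v : ℤ) - i by linarith)
      (lt_of_le_of_ne f1 (Ne.symm hne))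
    linarith
  obtain ⟨q, hq⟩ := exists_cross_step_eq_one h.ne
  obtain ⟨q', hq'⟩ := exists_cross_step_eq_one h'.ne
  have hst : step u' v' = step u v :=
    (eq_or_eq_neg_of_cross_eq_zero hq hq' hcr).resolve_right hdir
  have hp := dot_self_pos (step_ne_zero h.ne)
  have l1 : (latticeLength u' v' : ℤ) - i' + i ≤ latticeLength u v := by
    have := h.dot_le v' h'.right_mem (by rw [cross_sub_eq, d1, hcr]; simp)
    rw [dot_sub_eq, dot_sub_eq] at this
    have := le_of_mul_le_mul_left this (by exact_mod_cast latticeLength_pos h.ne)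
    have k1 : dot (step u v) (v' - u)
        = ((latticeLength u' v' : ℤ) - i' + i) * dot (step u v) (step u v) := by
      nth_rw 1 [hv']
      rw [hst]
      simp only [dot, Prod.fst_sub, Prod.snd_sub, Prod.fst_add, Prod.snd_add, Prod.smul_fst,
        Prod.smul_snd, smul_eq_mul]
      ring
    have k2 : dot (step u v) (v - u) = latticeLength u v * dot (step u v) (step u v) := by
      rw [dot_swap, dot_sub_eq]
    rw [k1, k2] at this
    exact le_of_mul_le_mul_right this hp
  have l2 : (latticeLength u v : ℤ) - i + i' ≤ latticeLength u' v' := by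
    have := h'.dot_le v h.right_mem (by rw [cross_sub_eq, d2, hcr]; simp)
    rw [dot_sub_eq, dot_sub_eq] at this
    have := le_of_mul_le_mul_left this (by exact_mod_cast latticeLength_pos h'.ne)
    have k1 : dot (step u' v') (v - u')
        = ((latticeLength u v : ℤ) - i + i') * dot (step u v) (step u v) := by
      nth_rw 1 [hv]
      rw [hst]
      simp only [dot, Prod.fst_sub, Prod.snd_sub, Prod.fst_add, Prod.snd_add, Prod.smul_fst,
        Prod.smul_snd, smul_eq_mul]
      ring
    have k2 : dot (step u' v') (v' - u') = latticeLength u' v' * dot (step u v) (step u v) := by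
      rw [dot_swap, dot_sub_eq, hst]
    rw [k1, k2] at this
    exact le_of_mul_le_mul_right this hp
  have hvv : v = v' := by
    refine hv.trans (Eq.trans ?_ hv'.symm)
    rw [← he, hst, show (latticeLength u v : ℤ) - i = latticeLength u' v' - i' by linarith]
  subst hvv
  have huu := h.left_unique h'
  subst huu
  exact ⟨rfl, rfl, by linarith⟩

/-- The oriented edges of the convex hull of `M`. -/
noncomputable def edgeFinset (M : Finset (ℤ × ℤ)) : Finset ((ℤ × ℤ) × (ℤ × ℤ)) :=
  open Classical in (M ×ˢ M).filter fun e => IsBoundaryEdge M e.1 e.2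

theorem mem_edgeFinset {e : (ℤ × ℤ) × (ℤ × ℤ)} :
    e ∈ edgeFinset M ↔ IsBoundaryEdge M e.1 e.2 := by
  classical
  simp only [edgeFinset, Finset.mem_filter, Finset.mem_product, and_iff_right_iff_imp]
  exact fun h => ⟨h.left_mem, h.right_mem⟩

/-- The direction of a vector: right, left, up or down, where vertical means exactly vertical. -/
def heading (p : ℤ × ℤ) : Fin 4 :=
  if 0 < p.1 then 0 else if p.1 < 0 then 1 else if 0 < p.2 then 2 else 3

/-- The coordinate by which the lattice points of the boundary are numbered: the column, except
on vertical edges. -/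
def shadow (p y : ℤ × ℤ) : ℤ := if p.1 = 0 then y.2 else y.1

/-- Two boundary points with the same heading and shadow are both extremal on the same side of the
same column or row, so they agree. -/
theorem eq_of_heading_eq_of_shadow_eq {p p' y y' : ℤ × ℤ} (hp : p ≠ 0) (hp' : p' ≠ 0)
    (h : heading p = heading p') (hs : shadow p y = shadow p' y')
    (h1 : 0 ≤ cross p (y' - y)) (h2 : 0 ≤ cross p' (y - y')) : y = y' ∧ p' ≠ -p := by
  obtain ⟨a, b⟩ := p
  obtain ⟨a', b'⟩ := p'
  obtain ⟨c, d⟩ := y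
  obtain ⟨c', d'⟩ := y'
  simp only [cross, Prod.fst_sub, Prod.snd_sub] at h1 h2
  simp only [shadow] at hs
  simp only [heading] at h
  simp only [ne_eq, Prod.ext_iff, Prod.fst_zero, Prod.snd_zero, Prod.neg_mk] at hp hp' ⊢
  rcases lt_trichotomy a 0 with ha | ha | ha
  · have ha' : a' < 0 := by
      rw [if_neg (by omega), if_pos ha] at h
      by_contra hc
      split_ifs at h <;> simp at h
    rw [if_neg (by omega), if_neg (by omega)] at hs
    subst hs
    simp only [sub_self, mul_zero, sub_zero] at h1 h2
    have := nonpos_of_mul_nonneg_right h1 ha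
    have := nonpos_of_mul_nonneg_right h2 ha'
    exact ⟨⟨rfl, by linarith⟩, by omega⟩
  · subst ha
    rw [if_pos rfl] at hs
    simp only [lt_irrefl, if_false] at h
    have ha' : a' = 0 := by
      by_contra hc
      rcases lt_or_gt_of_ne hc with hc | hc
      · rw [if_neg (by omega : ¬ 0 < a'), if_pos hc] at h
        split_ifs at h <;> simp at h
      · rw [if_pos hc] at h
        split_ifs at h <;> simp at h
    subst ha'
    rw [if_pos rfl] at hs
    subst hs
    simp only [lt_irrefl, if_false] at h
    simp only [sub_self, zero_mul, zero_sub] at h1 h2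
    by_cases hb : 0 < b
    · rw [if_pos hb] at h
      have hb' : 0 < b' := by
        by_contra hc
        rw [if_neg hc] at h
        simp at h
      have := nonpos_of_mul_nonpos_right (neg_nonneg.1 h1) hb
      have := nonpos_of_mul_nonpos_right (neg_nonneg.1 h2) hb'
      exact ⟨⟨by linarith, rfl⟩, by omega⟩
    · rw [if_neg hb] at h
      have hb' : ¬ 0 < b' := by
        intro hc
        rw [if_pos hc] at h
        simp at h
      have e : b < 0 := by omega
      have e' : b' < 0 := by omega
      have := nonneg_of_mul_nonpos_right (neg_nonneg.1 h1) e
      have := nonneg_of_mul_nonpos_right (neg_nonneg.1 h2) e'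
      exact ⟨⟨by linarith, rfl⟩, by omega⟩
  · have ha' : 0 < a' := by
      rw [if_pos ha] at h
      by_contra hc
      split_ifs at h <;> simp at h
    rw [if_neg (by omega), if_neg (by omega)] at hs
    subst hs
    simp only [sub_self, mul_zero, sub_zero] at h1 h2
    have := nonneg_of_mul_nonneg_right h1 ha
    have := nonneg_of_mul_nonneg_right h2 ha'
    exact ⟨⟨rfl, by linarith⟩, by omega⟩

/-- A convex lattice polygon in the square has at most `4 n` lattice points on its boundary: each
of them is the lowest or highest in its column, or the leftmost or rightmost in its row. -/
theorem sum_latticeLength_le {n : ℕ} (hM : M ⊆ box n) :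
    ∑ e ∈ edgeFinset M, latticeLength e.1 e.2 ≤ 4 * n := by
  classical
  have hcard : ((edgeFinset M).sigma fun e => Finset.range (latticeLength e.1 e.2)).card
      ≤ ((Finset.univ : Finset (Fin 4)) ×ˢ Finset.Ico (0 : ℤ) n).card := by
    refine Finset.card_le_card_of_injOn (fun a => (heading (step a.1.1 a.1.2),
      shadow (step a.1.1 a.1.2) (a.1.1 + (a.2 : ℤ) • step a.1.1 a.1.2))) ?_ ?_
    · rintro ⟨⟨u, v⟩, i⟩ ha
      simp only [Finset.coe_sigma, Set.mem_sigma_iff, Finset.mem_coe, mem_edgeFinset,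
        Finset.mem_range] at ha
      obtain ⟨h, hi⟩ := ha
      have hb : u + (i : ℤ) • step u v ∈ box n := by
        refine mem_box_of_convex (α := latticeLength u v - i) (β := i) (γ := 0)
          (by omega) (by omega) le_rfl (by omega) (hM h.left_mem) (hM h.right_mem)
          (hM h.right_mem) ?_
        linear_combination (-(i : ℤ)) • sub_eq_smul_step u v
      rw [mem_box] at hb
      simp only [Finset.coe_product, Finset.coe_univ, Set.mem_prod, Set.mem_univ, true_and,
        Finset.coe_Ico, Set.mem_Ico]
      unfold shadow
      split_ifs
      · exact hb.2
      · exact hb.1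
    · rintro ⟨⟨u, v⟩, i⟩ ha ⟨⟨u', v'⟩, i'⟩ ha' heq
      simp only [Finset.coe_sigma, Set.mem_sigma_iff, Finset.mem_coe, mem_edgeFinset,
        Finset.mem_range] at ha ha'
      obtain ⟨h, hi⟩ := ha
      obtain ⟨h', hi'⟩ := ha'
      simp only [Prod.mk.injEq] at heq
      have k1 := h.step_nonneg_add h' (i := i') (by omega) (by omega)
      have k2 := h'.step_nonneg_add h (i := i) (by omega) (by omega)
      have l : ∀ p y a : ℤ × ℤ, ∀ j : ℤ, cross p (y - (a + j • p)) = cross p (y - a) := by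
        intro p y a j
        simp only [cross, Prod.fst_sub, Prod.snd_sub, Prod.fst_add, Prod.snd_add, Prod.smul_fst,
          Prod.smul_snd, smul_eq_mul]
        ring
      obtain ⟨h1, h2⟩ := eq_of_heading_eq_of_shadow_eq (step_ne_zero h.ne) (step_ne_zero h'.ne)
        heq.1 heq.2 (by rw [l]; exact k1) (by rw [l]; exact k2)
      obtain ⟨rfl, rfl, h3⟩ := h.eq_of_common_point h' (by omega) (by omega)
        h1 h2
      obtain rfl : i = i' := by omega
      rfl
  simpa [Finset.card_sigma, Finset.card_product] using hcard

/-! ### Zeros seen by an edge -/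

/-- The point `x` can be added to `M`: no lattice point of the square outside `M`, other than `x`,
lies in the convex hull of `M ∪ {x}`. -/
def IsAddable (n : ℕ) (M : Finset (ℤ × ℤ)) (x : ℤ × ℤ) : Prop :=
  x ∈ box n ∧ ∀ y ∈ box n, y ∉ M → y ≠ x → IsSeparated (insert x M) y

/-- An addable point beyond an edge lies on the lattice line next to this edge. Otherwise the
triangle spanned by it and a primitive segment of the edge would contain another lattice point of
that line. -/
theorem IsAddable.cross_eq {n : ℕ} (hM : M ⊆ box n) (hx : IsAddable n M x)
    (h : IsBoundaryEdge M u v) (hneg : cross (v - u) (x - u) < 0) :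
    cross (step u v) (x - u) = -1 := by
  obtain ⟨q, hq⟩ := exists_cross_step_eq_one h.ne
  have hs : (0 : ℤ) < latticeLength u v := by exact_mod_cast latticeLength_pos h.ne
  rw [cross_sub_eq] at hneg
  have hneg' : cross (step u v) (x - u) < 0 := by
    by_contra hc
    have := mul_nonneg hs.le (not_lt.1 hc)
    linarith
  set k : ℤ := - cross (step u v) (x - u) with hk
  have hk0 : 0 < k := by linarith
  by_contra hne
  have hk2 : 2 ≤ k := by omega
  set i : ℤ := cross (x - u) q
  have hxu : x - u = i • step u v - k • q := by
    have := eq_cross_smul hq (x - u)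
    rw [this]
    simp only [hk, i]
    module
  -- `y` is the first lattice point of the adjacent line on or past the segment `ux`, in the
  -- direction of the edge: `j` is `i / k` rounded up
  set j : ℤ := -((-i) / k)
  set r : ℤ := j * k - i with hr
  have hr' : r = (-i) % k := by
    have := Int.emod_add_mul_ediv (-i) k
    simp only [hr, j]
    linarith
  have hr0 : 0 ≤ r := by rw [hr']; exact Int.emod_nonneg _ hk0.ne'
  have hrk : r < k := by rw [hr']; exact Int.emod_lt_of_pos _ hk0
  set y : ℤ × ℤ := u + j • step u v - q with hy
  have hcy : cross (step u v) (y - u) = -1 := by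
    rw [hy, ← hq]
    simp only [cross, Prod.fst_sub, Prod.snd_sub, Prod.fst_add, Prod.snd_add, Prod.smul_fst,
      Prod.smul_snd, smul_eq_mul]
    ring
  have hyM : y ∉ M := fun hyM => by
    have := h.step_nonneg hyM
    linarith
  have hyx : y ≠ x := by
    rintro hyx
    rw [hyx] at hcy
    linarith
  set s : ℤ := (latticeLength u v : ℤ)
  have hα : 0 ≤ s * (k - 1) - r := by nlinarith
  have hsum : (s + r + (s * (k - 1) - r)) • y = s • x + r • v + (s * (k - 1) - r) • u := by
    have e1 : v - u = s • step u v := sub_eq_smul_step u v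
    rw [hy, hr]
    linear_combination (-s) • hxu + (i - j * k) • e1
  have hpos : 0 < s + r + (s * (k - 1) - r) := by nlinarith
  have hyb : y ∈ box n := mem_box_of_convex hs.le hr0 hα hpos hx.1 (hM h.right_mem)
    (hM h.left_mem) hsum
  exact not_isSeparated_of_convex hs.le hr0 hα hpos (Finset.mem_insert_self _ _)
    (Finset.mem_insert_of_mem h.right_mem) (Finset.mem_insert_of_mem h.left_mem) hsum
    (hx.2 y hyb hyM hyx)

theorem eq_of_cross_eq {p p' a b u w : ℤ × ℤ} (hp : cross p p' ≠ 0)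
    (h1 : cross p (a - u) = cross p (b - u)) (h2 : cross p' (a - w) = cross p' (b - w)) :
    a = b := by
  simp only [cross, Prod.fst_sub, Prod.snd_sub] at *
  refine Prod.ext ?_ ?_ <;> refine sub_eq_zero.1 ((mul_eq_zero.1 ?_).resolve_left hp)
  · linear_combination p'.1 * h1 - p.1 * h2
  · linear_combination p'.2 * h1 - p.2 * h2

/-- A line contains at most `n` points of the square. -/
theorem card_le_of_cross_eq {n : ℕ} {p u : ℤ × ℤ} (hp : p ≠ 0) {c : ℤ} (R : Finset (ℤ × ℤ))
    (hR : ∀ x ∈ R, x ∈ box n ∧ cross p (x - u) = c) : R.card ≤ n := by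
  have hn : (Finset.Ico (0 : ℤ) n).card = n := by simp
  by_cases h1 : p.1 = 0
  · have h2 : p.2 ≠ 0 := fun h2 => hp (Prod.ext h1 h2)
    rw [← hn]
    refine Finset.card_le_card_of_injOn Prod.snd (fun x hx => ?_) fun x hx y hy hxy => ?_
    · simpa using (mem_box.1 (hR x hx).1).2
    · have ex := (hR x hx).2
      rw [← (hR y hy).2] at ex
      simp only [cross, Prod.fst_sub, Prod.snd_sub, h1] at ex
      refine Prod.ext (mul_left_cancel₀ h2 ?_) hxy
      linarith
  · rw [← hn]
    refine Finset.card_le_card_of_injOn Prod.fst (fun x hx => ?_) fun x hx y hy hxy => ?_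
    · simpa using (mem_box.1 (hR x hx).1).1
    · have ex := (hR x hx).2
      rw [← (hR y hy).2] at ex
      simp only [cross, Prod.fst_sub, Prod.snd_sub] at ex
      refine Prod.ext hxy (mul_left_cancel₀ h1 ?_)
      rw [hxy] at ex
      linarith

theorem card_le_of_injOn_Icc {α : Type*} (R : Finset α) (i : α → ℤ) (a b : ℝ) (hab : a ≤ b)
    (hi : ∀ x ∈ R, a ≤ i x ∧ i x ≤ b) (hinj : Set.InjOn i R) : (R.card : ℝ) ≤ b - a + 1 := by
  have h1 : R.card ≤ (Finset.Icc ⌈a⌉ ⌊b⌋).card := by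
    refine Finset.card_le_card_of_injOn i (fun x hx => ?_) hinj
    have := hi x hx
    simp only [Finset.coe_Icc, Set.mem_Icc]
    exact ⟨Int.ceil_le.2 this.1, Int.le_floor.2 this.2⟩
  rw [Int.card_Icc] at h1
  have h2 : (R.card : ℝ) ≤ ((⌊b⌋ + 1 - ⌈a⌉).toNat : ℝ) := by exact_mod_cast h1
  refine h2.trans ?_
  rcases le_total 0 (⌊b⌋ + 1 - ⌈a⌉) with h | h
  · have : (((⌊b⌋ + 1 - ⌈a⌉).toNat : ℤ) : ℝ) = ((⌊b⌋ + 1 - ⌈a⌉ : ℤ) : ℝ) := by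
      rw [Int.toNat_of_nonneg h]
    rw [Int.cast_natCast] at this
    rw [this]
    push_cast
    linarith [Int.floor_le b, Int.le_ceil a]
  · rw [Int.toNat_of_nonpos h]
    push_cast
    linarith

/-- The lattice points on the line next to the edge `uv` that the neighbouring edges `wu` and `vz`
do not see. They lie on a segment whose length exceeds that of the edge by the sum of the
cotangents of the angles at `u` and `v` times the distance of the lines; `c` and `c'` are upper
bounds for the cotangents. -/
theorem card_strip_le (huv : u ≠ v) (R : Finset (ℤ × ℤ)) {c c' : ℝ} (hc : 0 ≤ c) (hc' : 0 ≤ c')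
    (hw : 0 < cross (v - u) (w - u)) (hz : 0 < cross (v - u) (z - v))
    (hcw : (dot (v - u) (w - u) : ℝ) ≤ c * cross (v - u) (w - u))
    (hcz : (- dot (v - u) (z - v) : ℝ) ≤ c' * cross (v - u) (z - v))
    (hR : ∀ x ∈ R, cross (step u v) (x - u) = -1 ∧ 0 ≤ cross (u - w) (x - w) ∧
      0 ≤ cross (z - v) (x - v)) :
    (R.card : ℝ) ≤ latticeLength u v + 1 + (c + c') := by
  obtain ⟨q, hq⟩ := exists_cross_step_eq_one huv
  have hsZ : (0 : ℤ) < latticeLength u v := by exact_mod_cast latticeLength_pos huv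
  have hs : (0 : ℝ) < latticeLength u v := by exact_mod_cast hsZ
  have e1 : v = u + (latticeLength u v : ℤ) • step u v := by rw [← sub_eq_smul_step]; abel
  rw [cross_sub_eq] at hw hz hcw hcz
  rw [dot_sub_eq] at hcw hcz
  set p := step u v with hp
  set s : ℕ := latticeLength u v with hsdef
  have hP1 : (1 : ℝ) ≤ dot p p := by
    have := dot_self_pos (step_ne_zero huv)
    exact_mod_cast this
  have hP : (0 : ℝ) < dot p p := by linarith
  have hw' : 0 < cross p (w - u) := pos_of_mul_pos_right hw hsZ.le
  have hz' : 0 < cross p (z - v) := pos_of_mul_pos_right hz hsZ.le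
  have hwR : (0 : ℝ) < cross p (w - u) := by exact_mod_cast hw'
  have hzR : (0 : ℝ) < cross p (z - v) := by exact_mod_cast hz'
  push_cast at hcw hcz
  have hcw' : (dot p (w - u) : ℝ) ≤ c * cross p (w - u) := by
    refine le_of_mul_le_mul_left ?_ hs
    linarith
  have hcz' : (- dot p (z - v) : ℝ) ≤ c' * cross p (z - v) := by
    refine le_of_mul_le_mul_left ?_ hs
    linarith
  have key := card_le_of_injOn_Icc R (fun x => cross (x - u) q)
    ((dot p q - c) / dot p p) (s + (dot p q + c') / dot p p) ?_ ?_ ?_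
  · refine key.trans ?_
    have : ((s : ℝ) + (dot p q + c') / dot p p) - (dot p q - c) / dot p p + 1
        = s + 1 + (c + c') / dot p p := by ring
    rw [this]
    gcongr
    exact div_le_self (by linarith) hP1
  · have : (dot p q - c) / dot p p ≤ ((dot p q + c') / dot p p : ℝ) := by
      gcongr
      linarith
    linarith
  · intro x hx
    obtain ⟨h1, h2, h3⟩ := hR x hx
    have hdx := eq_cross_smul hq (x - u)
    rw [h1] at hdx
    set i := cross (x - u) q with hi
    have hx1 : x = u + i • p - q := by
      have : x = u + (x - u) := by abel
      rw [this, hdx]; module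
    have h2' : (0 : ℤ) ≤ cross (i • p - q) (w - u) := by
      have : cross (i • p - q) (w - u) = cross (u - w) (x - w) := by
        rw [hx1]
        simp only [cross, Prod.fst_sub, Prod.snd_sub, Prod.fst_add, Prod.snd_add, Prod.smul_fst,
          Prod.smul_snd, smul_eq_mul]
        ring
      rw [this]; exact h2
    have h3' : (0 : ℤ) ≤ cross (z - v) ((i - s) • p - q) := by
      have : x - v = (i - s) • p - q := by
        nth_rw 1 [e1]
        rw [hx1]; module
      rw [← this]; exact h3
    have g2 : dot p p * cross (i • p - q) (w - u)
        = (i * dot p p - dot p q) * cross p (w - u) + cross p q * dot p (w - u) := by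
      simp only [cross, dot, Prod.fst_sub, Prod.snd_sub, Prod.smul_fst, Prod.smul_snd, smul_eq_mul]
      ring
    have g3 : dot p p * cross (z - v) ((i - s) • p - q)
        = -((i - s) * dot p p - dot p q) * cross p (z - v) - cross p q * dot p (z - v) := by
      simp only [cross, dot, Prod.fst_sub, Prod.snd_sub, Prod.smul_fst, Prod.smul_snd, smul_eq_mul]
      ring
    rw [hq, one_mul] at g2 g3
    have hPZ : (0 : ℤ) < dot p p := by exact_mod_cast hP
    have k2 : 0 ≤ (i * dot p p - dot p q) * cross p (w - u) + dot p (w - u) := by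
      rw [← g2]; positivity
    have k3 : 0 ≤ -((i - s) * dot p p - dot p q) * cross p (z - v) - dot p (z - v) := by
      rw [← g3]; positivity
    have k2R : (0 : ℝ) ≤ (i * dot p p - dot p q) * cross p (w - u) + dot p (w - u) := by
      exact_mod_cast k2
    have k3R : (0 : ℝ) ≤ -((i - s) * dot p p - dot p q) * cross p (z - v) - dot p (z - v) := by
      exact_mod_cast k3
    constructor
    · rw [div_le_iff₀ hP]
      have : (0 : ℝ) ≤ (i * dot p p - dot p q + c) * cross p (w - u) := by linarith
      have := nonneg_of_mul_nonneg_left this hwR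
      linarith
    · rw [← sub_le_iff_le_add', le_div_iff₀ hP]
      have : (0 : ℝ) ≤ (-((i - s) * dot p p - dot p q) + c') * cross p (z - v) := by linarith
      have := nonneg_of_mul_nonneg_left this hzR
      linarith
  · intro x hx y hy hxy
    refine eq_of_cross_eq (p := p) (p' := q) (u := u) (w := u) (by rw [hq]; simp) ?_ ?_
    · rw [(hR x hx).1, (hR y hy).1]
    · rw [cross_swap q, cross_swap q]
      exact congrArg Neg.neg hxy

end

/-! ### Acute vertices -/

section

variable {M : Finset (ℤ × ℤ)} {u v w z x : ℤ × ℤ}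

/-- The vertex `u` is acute: the edges `wu` and `uv` meeting there make an acute angle. -/
def IsAcuteVertex (M : Finset (ℤ × ℤ)) (u : ℤ × ℤ) : Prop :=
  ∃ w v, IsBoundaryEdge M w u ∧ IsBoundaryEdge M u v ∧ 0 < cross (v - u) (w - u) ∧
    0 < dot (v - u) (w - u)

/-- The coordinate functions `x`, `y` and their negatives. -/
def signedCoord : Fin 4 → ℤ × ℤ → ℤ
  | 0 => fun a => a.1
  | 1 => fun a => -a.1
  | 2 => fun a => a.2
  | 3 => fun a => -a.2

theorem signedCoord_add (t : Fin 4) (a b : ℤ × ℤ) :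
    signedCoord t (a + b) = signedCoord t a + signedCoord t b := by
  fin_cases t <;> simp [signedCoord] <;> ring

theorem signedCoord_smul (t : Fin 4) (k : ℤ) (a : ℤ × ℤ) :
    signedCoord t (k • a) = k * signedCoord t a := by
  fin_cases t <;> simp [signedCoord]

theorem signedCoord_sub (t : Fin 4) (a b : ℤ × ℤ) :
    signedCoord t (a - b) = signedCoord t a - signedCoord t b := by
  fin_cases t <;> simp [signedCoord] <;> ring

/-- At an acute vertex one of the four coordinate directions is strictly extremal, since one of
the two products in the positive scalar product of the edge vectors is positive. -/
theorem IsAcuteVertex.exists_signedCoord_lt (h : IsAcuteVertex M u) :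
    ∃ t, ∀ m ∈ M, m ≠ u → signedCoord t u < signedCoord t m := by
  obtain ⟨w, v, hw, hv, hc, hd⟩ := h
  have ht : ∃ t, 0 < signedCoord t (v - u) ∧ 0 < signedCoord t (w - u) := by
    have h1 : 0 < (v - u).1 * (w - u).1 ∨ 0 < (v - u).2 * (w - u).2 := by
      unfold dot at hd
      by_contra! h
      linarith
    rcases h1 with h1 | h1
    · rcases mul_pos_iff.1 h1 with h1 | h1
      · exact ⟨0, h1⟩
      · exact ⟨1, by simpa [signedCoord] using h1⟩
    · rcases mul_pos_iff.1 h1 with h1 | h1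
      · exact ⟨2, h1⟩
      · exact ⟨3, by simpa [signedCoord] using h1⟩
  obtain ⟨t, tv, tw⟩ := ht
  refine ⟨t, fun m hm hmu => ?_⟩
  set α := cross (m - u) (w - u) with hα
  set β := cross (v - u) (m - u) with hβ
  have hβ0 : 0 ≤ β := hv.nonneg m hm
  have hα0 : 0 ≤ α := by
    have := hw.nonneg m hm
    have e : cross (u - w) (m - w) = α := by
      simp only [hα, cross, Prod.fst_sub, Prod.snd_sub]; ring
    rwa [e] at this
  have hlin : cross (v - u) (w - u) • (m - u) = α • (v - u) + β • (w - u) := by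
    refine Prod.ext ?_ ?_ <;>
    · simp only [hα, hβ, cross, Prod.fst_sub, Prod.snd_sub, Prod.smul_fst, Prod.smul_snd,
        Prod.fst_add, Prod.snd_add, smul_eq_mul]
      ring
  have hlt := congrArg (signedCoord t) hlin
  rw [signedCoord_add, signedCoord_smul, signedCoord_smul, signedCoord_smul] at hlt
  have hpos : 0 < α * signedCoord t (v - u) + β * signedCoord t (w - u) := by
    rcases hα0.lt_or_eq with h1 | h1
    · have := mul_pos h1 tv
      have := mul_nonneg hβ0 tw.le
      linarith
    · rcases hβ0.lt_or_eq with h2 | h2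
      · have := mul_pos h2 tw
        have := mul_nonneg hα0 tv.le
        linarith
      · rw [← h1, ← h2, zero_smul, zero_smul, add_zero] at hlin
        exact absurd (sub_eq_zero.1 ((smul_eq_zero.1 hlin).resolve_left hc.ne')) hmu
  rw [← hlt] at hpos
  have := pos_of_mul_pos_right hpos hc.le
  rw [signedCoord_sub] at this
  linarith

open Classical in
theorem card_acute_le (M : Finset (ℤ × ℤ)) : (M.filter (IsAcuteVertex M)).card ≤ 4 := by
  have h : ∀ u, ∃ t, u ∈ M.filter (IsAcuteVertex M) →
      ∀ m ∈ M, m ≠ u → signedCoord t u < signedCoord t m := by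
    intro u
    by_cases hu : u ∈ M.filter (IsAcuteVertex M)
    · obtain ⟨t, ht⟩ := (Finset.mem_filter.1 hu).2.exists_signedCoord_lt
      exact ⟨t, fun _ => ht⟩
    · exact ⟨0, fun h => absurd h hu⟩
  choose t ht using h
  have := Finset.card_le_card_of_injOn (s := M.filter (IsAcuteVertex M))
    (t := (Finset.univ : Finset (Fin 4))) t (fun _ _ => Finset.mem_coe.2 (Finset.mem_univ _))
    (by
      intro a ha b hb hab
      by_contra hne
      have h1 := ht a ha b (Finset.mem_filter.1 hb).1 (Ne.symm hne)
      have h2 := ht b hb a (Finset.mem_filter.1 ha).1 hne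
      rw [hab] at h1
      exact lt_asymm h1 h2)
  simpa using this

/-- The addable points beyond the edge `uv` are few: one is seen by the previous edge as well, one
by the next edge as well, and the others lie in the strip of `card_strip_le`, on which only acute
angles at the ends of the edge have a widening effect. Here `K` bounds all cotangents. -/
theorem card_seen_le {n : ℕ} (hS : Spans M) (hM : M ⊆ box n) {K : ℝ} (hK0 : 0 ≤ K)
    (hK : ∀ u v w, IsBoundaryEdge M w u → IsBoundaryEdge M u v → 0 < cross (v - u) (w - u) →
      (dot (v - u) (w - u) : ℝ) ≤ K * cross (v - u) (w - u))
    (h : IsBoundaryEdge M u v) (Z : Finset (ℤ × ℤ))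
    (hZ : ∀ x ∈ Z, IsAddable n M x ∧ cross (v - u) (x - u) < 0) :
    (Z.card : ℝ) ≤ latticeLength u v + 3 +
      open Classical in if IsAcuteVertex M u ∨ IsAcuteVertex M v then min (n : ℝ) (2 * K) else 0 := by
  classical
  obtain ⟨w, hw, hw0⟩ := h.exists_prev hS
  obtain ⟨z, hz, hz0⟩ := h.exists_next hS
  set A := Z.filter fun x => cross (u - w) (x - w) < 0 with hA
  set B := Z.filter fun x => cross (z - v) (x - v) < 0 with hB
  set R := Z.filter fun x => 0 ≤ cross (u - w) (x - w) ∧ 0 ≤ cross (z - v) (x - v) with hR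
  have hline : ∀ x ∈ Z, cross (step u v) (x - u) = -1 := fun x hx =>
    (hZ x hx).1.cross_eq hM h (hZ x hx).2
  have par : ∀ a b : ℤ × ℤ, cross (v - u) (b - a) ≠ 0 → cross (step u v) (step a b) ≠ 0 := by
    intro a b hab h0
    apply hab
    rw [cross_sub_eq, cross_swap, cross_sub_eq, cross_swap, h0]
    simp
  have hAc : A.card ≤ 1 := by
    rw [Finset.card_le_one]
    intro a ha b hb
    obtain ⟨ha1, ha2⟩ := Finset.mem_filter.1 ha
    obtain ⟨hb1, hb2⟩ := Finset.mem_filter.1 hb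
    refine eq_of_cross_eq (p := step u v) (p' := step w u) (u := u) (w := w) (par w u ?_) ?_ ?_
    · have : cross (v - u) (u - w) = - cross (v - u) (w - u) := by
        simp only [cross, Prod.fst_sub, Prod.snd_sub]; ring
      omega
    · rw [hline a ha1, hline b hb1]
    · rw [(hZ a ha1).1.cross_eq hM hw ha2, (hZ b hb1).1.cross_eq hM hw hb2]
  have hBc : B.card ≤ 1 := by
    rw [Finset.card_le_one]
    intro a ha b hb
    obtain ⟨ha1, ha2⟩ := Finset.mem_filter.1 ha
    obtain ⟨hb1, hb2⟩ := Finset.mem_filter.1 hb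
    refine eq_of_cross_eq (p := step u v) (p' := step v z) (u := u) (w := v) (par v z hz0.ne')
      ?_ ?_
    · rw [hline a ha1, hline b hb1]
    · rw [(hZ a ha1).1.cross_eq hM hz ha2, (hZ b hb1).1.cross_eq hM hz hb2]
  have hcover : Z ⊆ A ∪ B ∪ R := by
    intro x hx
    simp only [hA, hB, hR, Finset.mem_union, Finset.mem_filter]
    by_cases h1 : cross (u - w) (x - w) < 0
    · exact Or.inl (Or.inl ⟨hx, h1⟩)
    · by_cases h2 : cross (z - v) (x - v) < 0
      · exact Or.inl (Or.inr ⟨hx, h2⟩)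
      · exact Or.inr ⟨hx, not_lt.1 h1, not_lt.1 h2⟩
  have hcard : Z.card ≤ 2 + R.card := by
    have h1 := Finset.card_le_card hcover
    have h2 := Finset.card_union_le (A ∪ B) R
    have h3 := Finset.card_union_le A B
    omega
  have hcardR : (Z.card : ℝ) ≤ 2 + R.card := by exact_mod_cast hcard
  have hRline : ∀ x ∈ R, cross (step u v) (x - u) = -1 ∧ 0 ≤ cross (u - w) (x - w) ∧
      0 ≤ cross (z - v) (x - v) := fun x hx =>
    ⟨hline x (Finset.mem_filter.1 hx).1, (Finset.mem_filter.1 hx).2⟩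
  have sd : dot (z - v) (u - v) = - dot (v - u) (z - v) := by
    simp only [dot, Prod.fst_sub, Prod.snd_sub]; ring
  have sc : cross (z - v) (u - v) = cross (v - u) (z - v) := by
    simp only [cross, Prod.fst_sub, Prod.snd_sub]; ring
  split_ifs with hac
  · have h1 : (R.card : ℝ) ≤ n := by
      exact_mod_cast card_le_of_cross_eq (n := n) (step_ne_zero h.ne) R (c := -1) (u := u)
        fun x hx => ⟨(hZ x (Finset.mem_filter.1 hx).1).1.1, (hRline x hx).1⟩
    have hkz := hK v z u h hz (by rw [sc]; exact hz0)
    rw [sd, sc] at hkz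
    push_cast at hkz
    have h2 := card_strip_le h.ne R hK0 hK0 hw0 hz0 (hK u v w hw h hw0) hkz hRline
    have h3 : (0 : ℝ) ≤ latticeLength u v := Nat.cast_nonneg _
    rcases min_choice (n : ℝ) (2 * K) with h4 | h4 <;> rw [h4] <;> linarith
  · push Not at hac
    have h1 : dot (v - u) (w - u) ≤ 0 := by
      by_contra! hc
      exact hac.1 ⟨w, v, hw, h, hw0, hc⟩
    have h2 : - dot (v - u) (z - v) ≤ 0 := by
      by_contra! hc
      exact hac.2 ⟨u, z, h, hz, by rw [sc]; exact hz0, by rw [sd]; exact hc⟩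
    have h3 := card_strip_le h.ne R le_rfl le_rfl hw0 hz0
      (by rw [zero_mul]; exact_mod_cast h1) (by rw [zero_mul]; exact_mod_cast h2) hRline
    linarith

/-- The bound for essential points in terms of the number of lattice points on the boundary. -/
theorem card_add_card_le {n : ℕ} (hS : Spans M) (hM : M ⊆ box n) {K : ℝ} (hK0 : 0 ≤ K)
    (hK : ∀ u v w, IsBoundaryEdge M w u → IsBoundaryEdge M u v → 0 < cross (v - u) (w - u) →
      (dot (v - u) (w - u) : ℝ) ≤ K * cross (v - u) (w - u))
    (O Z : Finset (ℤ × ℤ)) (hO : ∀ x ∈ O, x ∈ M ∧ IsSeparated (M.erase x) x)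
    (hZ : ∀ x ∈ Z, IsAddable n M x ∧ IsSeparated M x) :
    (O.card + Z.card : ℝ) ≤
      5 * ∑ e ∈ edgeFinset M, (latticeLength e.1 e.2 : ℝ) + 8 * min (n : ℝ) (2 * K) := by
  classical
  set E := edgeFinset M with hE
  set μ := min (n : ℝ) (2 * K) with hμ
  have hμ0 : 0 ≤ μ := le_min (Nat.cast_nonneg _) (by linarith)
  have hlen : ∀ e ∈ E, 1 ≤ latticeLength e.1 e.2 := fun e he =>
    latticeLength_pos (mem_edgeFinset.1 he).ne
  have hEcard : (E.card : ℝ) ≤ ∑ e ∈ E, (latticeLength e.1 e.2 : ℝ) := by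
    have := Finset.card_nsmul_le_sum E (fun e => latticeLength e.1 e.2) 1 hlen
    rw [smul_eq_mul, mul_one] at this
    exact_mod_cast this
  have hOcard : (O.card : ℝ) ≤ E.card := by
    have h1 : O ⊆ E.image Prod.snd := by
      intro x hx
      obtain ⟨w, hw⟩ := exists_edge_of_isSeparated_erase hS (hO x hx).1 (hO x hx).2
      exact Finset.mem_image.2 ⟨(w, x), mem_edgeFinset.2 hw, rfl⟩
    exact_mod_cast (Finset.card_le_card h1).trans Finset.card_image_le
  have hacute : ((E.filter fun e => IsAcuteVertex M e.1 ∨ IsAcuteVertex M e.2).card : ℝ) ≤ 8 := by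
    rw [Finset.filter_or]
    have h1 : (E.filter fun e => IsAcuteVertex M e.1).card ≤ (M.filter (IsAcuteVertex M)).card := by
      refine Finset.card_le_card_of_injOn Prod.fst (fun e he => ?_) fun e he e' he' hee => ?_
      · obtain ⟨h1, h2⟩ := Finset.mem_filter.1 he
        exact Finset.mem_coe.2 (Finset.mem_filter.2 ⟨(mem_edgeFinset.1 h1).left_mem, h2⟩)
      · have h1 := mem_edgeFinset.1 (Finset.mem_filter.1 he).1
        have h2 := mem_edgeFinset.1 (Finset.mem_filter.1 he').1
        rw [← hee] at h2
        exact Prod.ext hee (h1.right_unique h2)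
    have h2 : (E.filter fun e => IsAcuteVertex M e.2).card ≤ (M.filter (IsAcuteVertex M)).card := by
      refine Finset.card_le_card_of_injOn Prod.snd (fun e he => ?_) fun e he e' he' hee => ?_
      · obtain ⟨h1, h2⟩ := Finset.mem_filter.1 he
        exact Finset.mem_coe.2 (Finset.mem_filter.2 ⟨(mem_edgeFinset.1 h1).right_mem, h2⟩)
      · have h1 := mem_edgeFinset.1 (Finset.mem_filter.1 he).1
        have h2 := mem_edgeFinset.1 (Finset.mem_filter.1 he').1
        rw [← hee] at h2
        exact Prod.ext (h1.left_unique h2) hee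
    have h3 := card_acute_le M
    have h4 := Finset.card_union_le (E.filter fun e => IsAcuteVertex M e.1)
      (E.filter fun e => IsAcuteVertex M e.2)
    exact_mod_cast (by omega : _ ≤ 8)
  have hZcard : (Z.card : ℝ) ≤ ∑ e ∈ E, ((latticeLength e.1 e.2 : ℝ) + 3 +
      if IsAcuteVertex M e.1 ∨ IsAcuteVertex M e.2 then μ else 0) := by
    have h1 : Z ⊆ E.biUnion fun e => Z.filter fun x => cross (e.2 - e.1) (x - e.1) < 0 := by
      intro x hx
      obtain ⟨u, v, huv, hneg⟩ := exists_edge_of_isSeparated hS (hZ x hx).2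
      exact Finset.mem_biUnion.2 ⟨(u, v), mem_edgeFinset.2 huv, Finset.mem_filter.2 ⟨hx, hneg⟩⟩
    have h2 := (Finset.card_le_card h1).trans Finset.card_biUnion_le
    have h3 : (Z.card : ℝ) ≤
        ∑ e ∈ E, ((Z.filter fun x => cross (e.2 - e.1) (x - e.1) < 0).card : ℝ) := by
      exact_mod_cast h2
    refine h3.trans (Finset.sum_le_sum fun e he => ?_)
    have := card_seen_le hS hM hK0 hK (mem_edgeFinset.1 he)
      (Z.filter fun x => cross (e.2 - e.1) (x - e.1) < 0) fun x hx =>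
        ⟨(hZ x (Finset.mem_filter.1 hx).1).1, (Finset.mem_filter.1 hx).2⟩
    convert this
  rw [Finset.sum_add_distrib, Finset.sum_add_distrib, ← Finset.sum_filter, Finset.sum_const,
    Finset.sum_const, nsmul_eq_mul, nsmul_eq_mul] at hZcard
  have := mul_le_mul_of_nonneg_right hacute hμ0
  linarith

end

/-! ### Lattice points in the Euclidean plane -/

/-- A lattice point as a point of the Euclidean plane. -/
noncomputable def embed (a : ℤ × ℤ) : EuclideanSpace ℝ (Fin 2) :=
  WithLp.toLp 2 ![(a.1 : ℝ), (a.2 : ℝ)]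

@[simp]
theorem embed_apply_zero (a : ℤ × ℤ) : embed a 0 = a.1 := by simp [embed]

@[simp]
theorem embed_apply_one (a : ℤ × ℤ) : embed a 1 = a.2 := by simp [embed]

theorem ext_plane {y z : EuclideanSpace ℝ (Fin 2)} (h0 : y 0 = z 0) (h1 : y 1 = z 1) : y = z := by
  ext i
  fin_cases i
  · exact h0
  · exact h1

theorem embed_injective : Function.Injective embed := by
  intro a b h
  have h0 := congrArg (fun z : EuclideanSpace ℝ (Fin 2) => z 0) h
  have h1 := congrArg (fun z : EuclideanSpace ℝ (Fin 2) => z 1) h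
  simp only [embed_apply_zero, embed_apply_one] at h0 h1
  exact Prod.ext (by exact_mod_cast h0) (by exact_mod_cast h1)

theorem embed_sub (a b : ℤ × ℤ) : embed (a - b) = embed a - embed b :=
  ext_plane (by simp) (by simp)

theorem inner_embed_left (a : ℤ × ℤ) (z : EuclideanSpace ℝ (Fin 2)) :
    inner ℝ (embed a) z = a.1 * z 0 + a.2 * z 1 := by
  simp [PiLp.inner_apply, Fin.sum_univ_two]
  ring

theorem inner_embed (a b : ℤ × ℤ) : inner ℝ (embed a) (embed b) = (dot a b : ℝ) := by
  rw [inner_embed_left]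
  simp [dot]

theorem latticeLength_le_dist {u v : ℤ × ℤ} (h : u ≠ v) :
    (latticeLength u v : ℝ) ≤ dist (embed u) (embed v) := by
  rw [dist_comm, dist_eq_norm, ← embed_sub]
  refine abs_le_of_sq_le_sq' ?_ (norm_nonneg _) |>.2
  rw [← real_inner_self_eq_norm_sq, inner_embed, dot_sub_eq, dot_swap, dot_sub_eq]
  have hp := dot_self_pos (step_ne_zero h)
  have : (latticeLength u v : ℤ) ^ 2 ≤
      latticeLength u v * (latticeLength u v * dot (step u v) (step u v)) := by
    nlinarith [sq_nonneg (latticeLength u v : ℤ)]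
  exact_mod_cast this

/-! ### Edges of the convex hull -/

section

variable {M : Finset (ℤ × ℤ)} {u v w : ℤ × ℤ}

/-- The convex hull of a finite set of lattice points in the Euclidean plane. -/
noncomputable def latticeHull (M : Finset (ℤ × ℤ)) : Set (EuclideanSpace ℝ (Fin 2)) :=
  convexHull ℝ (embed '' M)

theorem embed_mem_latticeHull (h : u ∈ M) : embed u ∈ latticeHull M :=
  subset_convexHull ℝ _ ⟨u, h, rfl⟩

theorem latticeHull_le {a b c : ℝ} (h : ∀ m ∈ M, a * m.1 + b * m.2 ≤ c)
    {z : EuclideanSpace ℝ (Fin 2)} (hz : z ∈ latticeHull M) : a * z 0 + b * z 1 ≤ c := by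
  have hl : IsLinearMap ℝ fun z : EuclideanSpace ℝ (Fin 2) => a * z 0 + b * z 1 :=
    ⟨fun x y => by simp; ring, fun r x => by simp; ring⟩
  refine convexHull_min ?_ (convex_halfSpace_le hl c) hz
  rintro _ ⟨m, hm, rfl⟩
  simpa using h m hm

theorem IsBoundaryEdge.isEdge (h : IsBoundaryEdge M u v) :
    IsEdge (latticeHull M) (embed u) (embed v) := by
  refine ⟨fun he => h.ne (embed_injective he), fun _ => ?_⟩
  refine ⟨innerSL ℝ (embed ((v - u).2, -(v - u).1)), ?_⟩
  have hl : ∀ z : EuclideanSpace ℝ (Fin 2), innerSL ℝ (embed ((v - u).2, -(v - u).1)) z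
      = ((v - u).2 : ℝ) * z 0 - ((v - u).1 : ℝ) * z 1 := by
    intro z
    rw [innerSL_apply_apply, inner_embed_left]
    push_cast
    ring
  simp only [hl]
  set d := v - u with hd
  have hv : v = u + d := by rw [hd]; abel
  have hDZ := dot_self_pos h.sub_ne_zero
  have hD : (0 : ℝ) < d.1 * d.1 + d.2 * d.2 := by
    have : (0 : ℝ) < (dot d d : ℤ) := by exact_mod_cast hDZ
    simpa [dot] using this
  have hcr : ∀ z ∈ latticeHull M, (d.2 : ℝ) * z 0 - d.1 * z 1 ≤ d.2 * u.1 - d.1 * u.2 := by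
    intro z hz
    have := latticeHull_le (M := M) (a := d.2) (b := -d.1) (c := d.2 * u.1 - d.1 * u.2) ?_ hz
    · linarith
    · intro m hm
      have h1 : (0 : ℝ) ≤ (cross d (m - u) : ℤ) := by exact_mod_cast h.nonneg m hm
      simp only [cross, Prod.fst_sub, Prod.snd_sub] at h1
      push_cast at h1
      linarith
  ext x
  simp only [Set.mem_ofPred_eq]
  constructor
  · rintro ⟨a, b, ha, hb, hab, rfl⟩
    have hx : a • embed u + b • embed v ∈ latticeHull M :=
      convex_convexHull ℝ _ (embed_mem_latticeHull h.left_mem) (embed_mem_latticeHull h.right_mem)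
        ha hb hab
    refine ⟨hx, fun y hy => (hcr y hy).trans (le_of_eq ?_)⟩
    obtain rfl : a = 1 - b := by linarith
    simp only [hv, PiLp.add_apply, PiLp.smul_apply, embed_apply_zero, embed_apply_one, smul_eq_mul,
      Prod.fst_add, Prod.snd_add]
    push_cast
    ring
  · rintro ⟨hx, hmax⟩
    have h1 := hmax _ (embed_mem_latticeHull h.left_mem)
    have h2 := hcr x hx
    simp only [embed_apply_zero, embed_apply_one] at h1
    have h0 : (d.2 : ℝ) * (x 0 - u.1) - d.1 * (x 1 - u.2) = 0 := by linarith
    -- `C` is so large that the bounds for the points of `M` on the line `uv` hold on all of `M`,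
    -- and hence on the hull, once `C` times the (scaled) distance from this line is added
    set C : ℤ := ∑ m ∈ M, |dot d (m - u)| with hC
    have hCle : ∀ m ∈ M, |dot d (m - u)| ≤ C := fun m hm =>
      Finset.single_le_sum (f := fun m => |dot d (m - u)|) (fun _ _ => abs_nonneg _) hm
    have hlow : ∀ m ∈ M, - dot d (m - u) ≤ C * cross d (m - u) ∧
        dot d (m - u) ≤ dot d d + C * cross d (m - u) := by
      intro m hm
      have hc := hCle m hm
      have hn := neg_le_abs (dot d (m - u))
      have hp := le_abs_self (dot d (m - u))
      have hC0 : 0 ≤ C := (abs_nonneg _).trans hc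
      rcases (h.nonneg m hm).lt_or_eq with hcross | hcross
      · have : C * 1 ≤ C * cross d (m - u) := mul_le_mul_of_nonneg_left hcross hC0
        constructor <;> linarith
      · have k1 := h.dot_nonneg m hm hcross.symm
        have k2 := h.dot_le m hm hcross.symm
        rw [← hcross]
        constructor <;> linarith
    have low := latticeHull_le (M := M) (a := -d.1 + C * d.2) (b := -d.2 - C * d.1)
      (c := -d.1 * u.1 - d.2 * u.2 + C * (d.2 * u.1 - d.1 * u.2)) (fun m hm => by
        have : ((- dot d (m - u) : ℤ) : ℝ) ≤ (C * cross d (m - u) : ℤ) := by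
          exact_mod_cast (hlow m hm).1
        simp only [cross, dot, Prod.fst_sub, Prod.snd_sub] at this
        push_cast at this
        linarith) hx
    have high := latticeHull_le (M := M) (a := d.1 + C * d.2) (b := d.2 - C * d.1)
      (c := d.1 * u.1 + d.2 * u.2 + (d.1 * d.1 + d.2 * d.2) + C * (d.2 * u.1 - d.1 * u.2))
      (fun m hm => by
        have : ((dot d (m - u) : ℤ) : ℝ) ≤ (dot d d + C * cross d (m - u) : ℤ) := by
          exact_mod_cast (hlow m hm).2
        simp only [cross, dot, Prod.fst_sub, Prod.snd_sub] at this
        push_cast at this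
        linarith) hx
    have hC0 : (C : ℝ) * (d.2 * (x 0 - u.1) - d.1 * (x 1 - u.2)) = 0 := by rw [h0, mul_zero]
    set T : ℝ := d.1 * (x 0 - u.1) + d.2 * (x 1 - u.2) with hT
    have hT0 : 0 ≤ T := by linarith
    have hT1 : T ≤ d.1 * d.1 + d.2 * d.2 := by linarith
    have hτ := div_mul_cancel₀ T hD.ne'
    have hτ0 : 0 ≤ T / (d.1 * d.1 + d.2 * d.2) := div_nonneg hT0 hD.le
    have hτ1 : T / (d.1 * d.1 + d.2 * d.2) ≤ 1 := div_le_one_of_le₀ hT1 hD.le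
    set τ : ℝ := T / (d.1 * d.1 + d.2 * d.2)
    refine ⟨1 - τ, τ, sub_nonneg.2 hτ1, hτ0, by ring,
      ext_plane (mul_left_cancel₀ hD.ne' ?_) (mul_left_cancel₀ hD.ne' ?_)⟩
    · simp only [hv, PiLp.add_apply, PiLp.smul_apply, embed_apply_zero, smul_eq_mul, Prod.fst_add]
      push_cast
      linear_combination d.1 * hτ + d.1 * hT - d.2 * h0
    · simp only [hv, PiLp.add_apply, PiLp.smul_apply, embed_apply_one, smul_eq_mul, Prod.snd_add]
      push_cast
      linear_combination d.2 * hτ + d.2 * hT + d.1 * h0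

theorem left_mem_extremePoints_segment {E : Type*} [AddCommGroup E] [Module ℝ E] (a b : E) :
    a ∈ (segment ℝ a b).extremePoints ℝ := by
  rw [mem_extremePoints_iff_left]
  refine ⟨left_mem_segment ℝ a b, ?_⟩
  rw [segment_eq_image']
  rintro _ ⟨s, ⟨hs, -⟩, rfl⟩ _ ⟨t, ⟨ht, -⟩, rfl⟩ ⟨p, q, hp, hq, hpq, h⟩
  obtain rfl : p = 1 - q := by linarith
  have h1 : ((1 - q) * s + q * t) • (b - a) = 0 := by
    linear_combination (norm := module) (1 : ℝ) • h
  rcases smul_eq_zero.1 h1 with h2 | h2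
  · have k1 := mul_nonneg hp.le hs
    have k2 := mul_nonneg hq.le ht
    have : s = 0 := (mul_eq_zero.1 (by linarith : (1 - q) * s = 0)).resolve_left hp.ne'
    simp [this]
  · simp [h2]

theorem IsEdge.symm {P : Set (EuclideanSpace ℝ (Fin 2))} {a b : EuclideanSpace ℝ (Fin 2)}
    (h : IsEdge P a b) : IsEdge P b a :=
  ⟨h.1.symm, by rw [segment_symm]; exact h.2⟩

theorem IsEdge.left_mem_extremePoints {P : Set (EuclideanSpace ℝ (Fin 2))}
    {a b : EuclideanSpace ℝ (Fin 2)} (h : IsEdge P a b) : a ∈ P.extremePoints ℝ :=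
  h.2.isExtreme.extremePoints_subset_extremePoints (left_mem_extremePoints_segment a b)

theorem IsEdge.left_mem_image {a b : EuclideanSpace ℝ (Fin 2)}
    (h : IsEdge (latticeHull M) a b) : a ∈ embed '' (M : Set (ℤ × ℤ)) :=
  extremePoints_convexHull_subset h.left_mem_extremePoints

/-! ### Angles and perimeter -/

theorem finite_angles (M : Finset (ℤ × ℤ)) : (angles (latticeHull M)).Finite := by
  have hf : (embed '' (M : Set (ℤ × ℤ))).Finite := M.finite_toSet.image _
  refine ((hf.prod (hf.prod hf)).image fun t => EuclideanGeometry.angle t.1 t.2.1 t.2.2).subset ?_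
  rintro θ ⟨a, b, c, hba, hbc, -, rfl⟩
  exact ⟨(a, b, c), ⟨hba.symm.left_mem_image, hba.left_mem_image, hbc.symm.left_mem_image⟩, rfl⟩

theorem angles_nonneg {P : Set (EuclideanSpace ℝ (Fin 2))} {θ : ℝ} (h : θ ∈ angles P) : 0 ≤ θ := by
  obtain ⟨a, b, c, -, -, -, rfl⟩ := h
  exact EuclideanGeometry.angle_nonneg _ _ _

/-- Two edges from the same vertex do not overlap, as the nearer end would not be extreme. -/
theorem angles_pos {P : Set (EuclideanSpace ℝ (Fin 2))} {θ : ℝ} (h : θ ∈ angles P) : 0 < θ := by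
  refine lt_of_le_of_ne (angles_nonneg h) fun h0 => ?_
  obtain ⟨a, b, c, hba, hbc, hac, rfl⟩ := h
  obtain ⟨-, r, hr, hrc⟩ := InnerProductGeometry.angle_eq_zero_iff.1 h0.symm
  simp only [vsub_eq_sub] at hrc
  have ha := hba.symm.left_mem_extremePoints
  have hb := hba.left_mem_extremePoints
  have hc := hbc.symm.left_mem_extremePoints
  rcases lt_trichotomy r 1 with h1 | h1 | h1
  · refine hbc.1 ((mem_extremePoints_iff_left.1 hc).2 b hb.1 a ha.1
      ⟨1 - r, r, by linarith, hr, by ring, ?_⟩)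
    linear_combination (norm := module) (-1 : ℝ) • hrc
  · rw [h1, one_smul] at hrc
    exact hac (sub_left_injective hrc).symm
  · refine hba.1 ((mem_extremePoints_iff_left.1 ha).2 b hb.1 c hc.1
      ⟨1 - r⁻¹, r⁻¹, sub_pos.2 (inv_lt_one_of_one_lt₀ h1), inv_pos.2 hr, by ring, ?_⟩)
    have : r⁻¹ • (c - b) = a - b := by rw [hrc, inv_smul_smul₀ hr.ne']
    linear_combination (norm := module) (1 : ℝ) • this

theorem minAngle_pos_and_le {θ : ℝ} (h : θ ∈ angles (latticeHull M)) :
    0 < minAngle (latticeHull M) ∧ minAngle (latticeHull M) ≤ θ :=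
  ⟨angles_pos (Set.Nonempty.csInf_mem ⟨θ, h⟩ (finite_angles M)),
    csInf_le (finite_angles M).bddBelow h⟩

theorem minAngle_nonneg (P : Set (EuclideanSpace ℝ (Fin 2))) : 0 ≤ minAngle P :=
  Real.sInf_nonneg fun _ h => angles_nonneg h

/-- The cotangent of an angle `θ` of the polygon is at most `1 / θ`. -/
theorem dot_le_inv_minAngle_mul_cross (hw : IsBoundaryEdge M w u) (hv : IsBoundaryEdge M u v)
    (hc : 0 < cross (v - u) (w - u)) :
    (dot (v - u) (w - u) : ℝ) ≤ 1 / minAngle (latticeHull M) * cross (v - u) (w - u) := by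
  have hcR : (0 : ℝ) < cross (v - u) (w - u) := by exact_mod_cast hc
  set a := embed (v - u) with ha
  set b := embed (w - u) with hb
  set θ := InnerProductGeometry.angle a b with hθ
  have hmem : θ ∈ angles (latticeHull M) := by
    refine ⟨embed v, embed u, embed w, hv.isEdge, hw.isEdge.symm, fun h => ?_, ?_⟩
    · rw [embed_injective h] at hc
      simp [cross, mul_comm] at hc
    · simp only [hθ, ha, hb, embed_sub, EuclideanGeometry.angle, vsub_eq_sub]
  obtain ⟨hq, hqθ⟩ := minAngle_pos_and_le hmem
  rcases le_or_gt (dot (v - u) (w - u) : ℝ) 0 with hd | hd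
  · exact hd.trans (by positivity)
  have hcos : Real.cos θ * (‖a‖ * ‖b‖) = dot (v - u) (w - u) := by
    rw [InnerProductGeometry.cos_angle_mul_norm_mul_norm, inner_embed]
  have hsin : Real.sin θ * (‖a‖ * ‖b‖) = cross (v - u) (w - u) := by
    rw [InnerProductGeometry.sin_angle_mul_norm_mul_norm, inner_embed, inner_embed, inner_embed]
    have : (dot (v - u) (v - u) * dot (w - u) (w - u)
        - dot (v - u) (w - u) * dot (v - u) (w - u) : ℝ)
        = (cross (v - u) (w - u) : ℝ) ^ 2 := by
      simp only [dot, cross]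
      push_cast
      ring
    rw [this, Real.sqrt_sq hcR.le]
  have hnn : 0 ≤ ‖a‖ * ‖b‖ := by positivity
  have hcospos : 0 < Real.cos θ := by
    rw [← hcos] at hd
    exact pos_of_mul_pos_left hd hnn
  have hθ2 : θ < Real.pi / 2 := by
    by_contra! h
    have h1 := InnerProductGeometry.angle_le_pi a b
    have := Real.cos_nonpos_of_pi_div_two_le_of_le h (by linarith [Real.pi_pos])
    linarith
  have htan := Real.le_tan (InnerProductGeometry.angle_nonneg a b) hθ2
  rw [Real.tan_eq_sin_div_cos, le_div_iff₀ hcospos] at htan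
  have h1 : θ * dot (v - u) (w - u) ≤ cross (v - u) (w - u) := by
    rw [← hcos, ← hsin, ← mul_assoc]
    exact mul_le_mul_of_nonneg_right htan hnn
  rw [one_div, inv_mul_eq_div, le_div_iff₀ hq]
  have := mul_le_mul_of_nonneg_right hqθ hd.le
  linarith

theorem finite_edges (M : Finset (ℤ × ℤ)) : (edges (latticeHull M)).Finite := by
  have hf : (embed '' (M : Set (ℤ × ℤ))).Finite := M.finite_toSet.image _
  refine ((hf.prod hf).image fun t => segment ℝ t.1 t.2).subset ?_
  rintro e ⟨a, b, hab, rfl⟩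
  exact ⟨(a, b), ⟨hab.left_mem_image, hab.symm.left_mem_image⟩, rfl⟩

theorem extremePoints_segment_subset {E : Type*} [AddCommGroup E] [Module ℝ E] (a b : E) :
    (segment ℝ a b).extremePoints ℝ ⊆ {a, b} := by
  rw [← convexHull_pair]
  exact extremePoints_convexHull_subset

theorem segment_embed_injOn (hS : Spans M) :
    Set.InjOn (fun e : (ℤ × ℤ) × (ℤ × ℤ) => segment ℝ (embed e.1) (embed e.2))
      (edgeFinset M : Set ((ℤ × ℤ) × (ℤ × ℤ))) := by
  rintro ⟨u, v⟩ h ⟨u', v'⟩ h' heq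
  have h := mem_edgeFinset.1 h
  have h' := mem_edgeFinset.1 h'
  simp only at h h' heq
  have hu := left_mem_extremePoints_segment (embed u) (embed v)
  have hv := left_mem_extremePoints_segment (embed v) (embed u)
  rw [heq] at hu
  rw [segment_symm, heq] at hv
  have hu' : u = u' ∨ u = v' :=
    (extremePoints_segment_subset _ _ hu).imp (embed_injective ·) (embed_injective ·)
  have hv' : v = u' ∨ v = v' :=
    (extremePoints_segment_subset _ _ hv).imp (embed_injective ·) (embed_injective ·)
  rcases hu' with rfl | rfl
  · rw [h.right_unique h']
  · rcases hv' with rfl | rfl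
    · obtain ⟨m, hm, hm0⟩ := hS u (v - u) h.sub_ne_zero
      have h1 := h.nonneg m hm
      have h2 := h'.nonneg m hm
      have h3 : cross (u - v) (m - v) = - cross (v - u) (m - u) := by
        simp only [cross, Prod.fst_sub, Prod.snd_sub]; ring
      omega
    · exact absurd rfl h.ne

theorem sum_latticeLength_le_perimeter (hS : Spans M) :
    ∑ e ∈ edgeFinset M, (latticeLength e.1 e.2 : ℝ) ≤ perimeter (latticeHull M) := by
  classical
  rw [perimeter, finsum_mem_eq_finite_toFinset_sum _ (finite_edges M)]
  calc ∑ e ∈ edgeFinset M, (latticeLength e.1 e.2 : ℝ)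
      ≤ ∑ e ∈ edgeFinset M, Metric.diam (segment ℝ (embed e.1) (embed e.2)) := by
        refine Finset.sum_le_sum fun e he => ?_
        have h := mem_edgeFinset.1 he
        refine (latticeLength_le_dist h.ne).trans (Metric.dist_le_diam_of_mem ?_
          (left_mem_segment ℝ _ _) (right_mem_segment ℝ _ _))
        exact Metric.isBounded_closedBall.subset (segment_subset_closedBall_left _ _)
    _ = ∑ s ∈ (edgeFinset M).image fun e => segment ℝ (embed e.1) (embed e.2), Metric.diam s :=
        (Finset.sum_image (segment_embed_injOn hS)).symm
    _ ≤ _ := by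
        refine Finset.sum_le_sum_of_subset_of_nonneg (fun s hs => ?_) fun _ _ _ =>
          Metric.diam_nonneg
        obtain ⟨e, he, rfl⟩ := Finset.mem_image.1 hs
        exact (finite_edges M).mem_toFinset.2 ⟨_, _, (mem_edgeFinset.1 he).isEdge, rfl⟩

theorem spans_of_volume_pos (h : 0 < MeasureTheory.volume (latticeHull M)) : Spans M := by
  intro u d hd
  by_contra! hc
  refine h.ne' ?_
  set l := innerSL ℝ (embed (-d.2, d.1)) with hl
  set s : AffineSubspace ℝ (EuclideanSpace ℝ (Fin 2)) :=
    AffineSubspace.mk' (embed u) (LinearMap.ker l.toLinearMap) with hs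
  have hmem : ∀ z, z ∈ s ↔ (-(d.2 : ℝ)) * (z 0 - u.1) + d.1 * (z 1 - u.2) = 0 := by
    intro z
    rw [hs, AffineSubspace.mem_mk', LinearMap.mem_ker, vsub_eq_sub]
    change innerSL ℝ (embed (-d.2, d.1)) (z - embed u) = 0 ↔ _
    rw [innerSL_apply_apply, inner_embed_left]
    simp
  have htop : s ≠ ⊤ := by
    intro ht
    have h1 : embed (u + (-d.2, d.1)) ∈ s := by rw [ht]; trivial
    rw [hmem] at h1
    simp only [embed_apply_zero, embed_apply_one, Prod.fst_add, Prod.snd_add] at h1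
    push_cast at h1
    have h2 : (0 : ℝ) < (dot d d : ℤ) := by exact_mod_cast dot_self_pos hd
    simp only [dot] at h2
    push_cast at h2
    linarith
  refine MeasureTheory.measure_mono_null ?_
    (MeasureTheory.Measure.addHaar_affineSubspace MeasureTheory.volume s htop)
  refine convexHull_min ?_ s.convex
  rintro _ ⟨m, hm, rfl⟩
  have h0 := hc m hm
  have h1 : ((cross d (m - u) : ℤ) : ℝ) = 0 := by rw [h0]; simp
  simp only [cross, Prod.fst_sub, Prod.snd_sub] at h1
  push_cast at h1
  rw [SetLike.mem_coe, hmem, embed_apply_zero, embed_apply_one]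
  linarith

end

/-! ### Threshold functions -/

/-- A point of the cube as a lattice point. -/
def toLattice {n : ℕ} (x : Cube 2 n) : ℤ × ℤ := (((x 0 : ℕ) : ℤ), ((x 1 : ℕ) : ℤ))

/-- The set of ones of `f` as a set of lattice points. -/
def ones {n : ℕ} (f : Cube 2 n → Bool) : Finset (ℤ × ℤ) :=
  (Finset.univ.filter fun x => f x = true).image toLattice

section

variable {n : ℕ} {f g : Cube 2 n → Bool} {x y : Cube 2 n}

theorem toLattice_injective : Function.Injective (toLattice (n := n)) := by
  intro x y h
  have h0 := congrArg Prod.fst h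
  have h1 := congrArg Prod.snd h
  simp only [toLattice] at h0 h1
  funext i
  fin_cases i
  · exact Fin.ext (by exact_mod_cast h0)
  · exact Fin.ext (by exact_mod_cast h1)

theorem toLattice_mem_ones : toLattice x ∈ ones f ↔ f x = true := by
  simp only [ones, Finset.mem_image, Finset.mem_filter, Finset.mem_univ, true_and]
  constructor
  · rintro ⟨y, hy, hyx⟩
    rwa [← toLattice_injective hyx]
  · exact fun h => ⟨x, h, rfl⟩

theorem mem_ones {m : ℤ × ℤ} : m ∈ ones f ↔ ∃ y, f y = true ∧ toLattice y = m := by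
  simp [ones]

theorem toLattice_mem_box (x : Cube 2 n) : toLattice x ∈ box n := by
  rw [mem_box]
  simp only [toLattice]
  have h0 := (x 0).isLt
  have h1 := (x 1).isLt
  omega

theorem exists_toLattice_eq {m : ℤ × ℤ} (h : m ∈ box n) : ∃ x : Cube 2 n, toLattice x = m := by
  rw [mem_box] at h
  refine ⟨![⟨m.1.toNat, by omega⟩, ⟨m.2.toNat, by omega⟩], Prod.ext ?_ ?_⟩
  · simp [toLattice, h.1.1]
  · simp [toLattice, h.2.1]

theorem ones_subset_box : ones f ⊆ box n := by
  intro m hm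
  obtain ⟨y, -, rfl⟩ := mem_ones.1 hm
  exact toLattice_mem_box y

theorem hull_eq : hull f = latticeHull (ones f) := by
  have h : ∀ x : Cube 2 n, toSpace x = embed (toLattice x) := fun x =>
    ext_plane (by simp [toSpace, toLattice]) (by simp [toSpace, toLattice])
  rw [hull, latticeHull]
  congr 1
  ext z
  simp only [Set.mem_image, level, Set.mem_ofPred_eq, Finset.mem_coe, mem_ones]
  constructor
  · rintro ⟨x, hx, rfl⟩
    exact ⟨_, ⟨x, hx, rfl⟩, (h x).symm⟩
  · rintro ⟨_, ⟨x, hx, rfl⟩, rfl⟩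
    exact ⟨x, hx, h x⟩

/-- A zero of a threshold function is separated from the ones by a violated inequality. -/
theorem isSeparated_ones (hf : f ∈ thresholdClassAll 2 n) (hx : f x = false) :
    IsSeparated (ones f) (toLattice x) := by
  obtain ⟨k, -, a, b, hab⟩ := hf
  have h1 : x ∉ level true f := by simp [level, hx]
  rw [hab, Set.mem_ofPred_eq] at h1
  push Not at h1
  obtain ⟨i, hi⟩ := h1
  refine ⟨a i 0, a i 1, fun m hm => ?_⟩
  obtain ⟨y, hy, rfl⟩ := mem_ones.1 hm
  have h2 : y ∈ level true f := hy
  rw [hab] at h2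
  have h3 := h2 i
  rw [Fin.sum_univ_two] at h3 hi
  simp only [toLattice, Int.cast_natCast]
  linarith

theorem IsSeparated.mono {M N : Finset (ℤ × ℤ)} {y : ℤ × ℤ} (h : IsSeparated N y) (hMN : M ⊆ N) :
    IsSeparated M y := by
  obtain ⟨a, b, hab⟩ := h
  exact ⟨a, b, fun m hm => hab m (hMN hm)⟩

theorem isSeparated_erase_of_essential (hx : x ∈ essentialPoints f (thresholdClassAll 2 n))
    (hfx : f x = true) : IsSeparated ((ones f).erase (toLattice x)) (toLattice x) := by
  obtain ⟨g, hg, hne, heq⟩ := hx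
  have hgx : g x = false := by
    cases h : g x
    · rfl
    · exact absurd (hfx.trans h.symm) hne
  refine (isSeparated_ones hg hgx).mono fun m hm => ?_
  obtain ⟨hmx, hm⟩ := Finset.mem_erase.1 hm
  obtain ⟨y, hy, rfl⟩ := mem_ones.1 hm
  rw [toLattice_mem_ones, ← heq y (fun h => hmx (congrArg _ h))]
  exact hy

theorem isAddable_of_essential (hx : x ∈ essentialPoints f (thresholdClassAll 2 n))
    (hfx : f x = false) : IsAddable n (ones f) (toLattice x) := by
  obtain ⟨g, hg, hne, heq⟩ := hx
  have hgx : g x = true := by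
    cases h : g x
    · exact absurd (hfx.trans h.symm) hne
    · rfl
  refine ⟨toLattice_mem_box x, fun m hm hmM hmx => ?_⟩
  obtain ⟨y, rfl⟩ := exists_toLattice_eq hm
  have hyx : y ≠ x := fun h => hmx (congrArg _ h)
  have hgy : g y = false := by
    rw [← heq y hyx]
    rw [toLattice_mem_ones] at hmM
    simpa using hmM
  refine (isSeparated_ones hg hgy).mono fun m hm => ?_
  rcases Finset.mem_insert.1 hm with rfl | hm
  · exact toLattice_mem_ones.2 hgx
  · obtain ⟨z, hz, rfl⟩ := mem_ones.1 hm
    rw [toLattice_mem_ones, ← heq z ?_]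
    · exact hz
    · rintro rfl
      rw [hfx] at hz
      exact absurd hz (by simp)

theorem ncard_essentialPoints_le (hf : f ∈ thresholdClassAll 2 n)
    (hvol : 0 < MeasureTheory.volume (hull f)) :
    ((essentialPoints f (thresholdClassAll 2 n)).ncard : ℝ) ≤
      28 * min (n : ℝ) (perimeter (hull f) + 1 / minAngle (hull f)) := by
  classical
  rw [hull_eq] at hvol ⊢
  have hS := spans_of_volume_pos hvol
  set S := essentialPoints f (thresholdClassAll 2 n)
  set O := (Finset.univ.filter fun x => x ∈ S ∧ f x = true).image toLattice
  set Z := (Finset.univ.filter fun x => x ∈ S ∧ f x = false).image toLattice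
  have hcard : (S.ncard : ℝ) ≤ O.card + Z.card := by
    rw [Finset.card_image_of_injective _ toLattice_injective,
      Finset.card_image_of_injective _ toLattice_injective]
    have h1 : S = ((Finset.univ.filter fun x => x ∈ S ∧ f x = true) ∪
        (Finset.univ.filter fun x => x ∈ S ∧ f x = false) : Finset (Cube 2 n)) := by
      ext x
      simp only [Finset.coe_union, Finset.coe_filter, Finset.mem_univ, true_and, Set.mem_union,
        Set.mem_ofPred_eq]
      cases f x <;> simp
    rw [h1, Set.ncard_coe_finset]
    rw [← h1]
    exact_mod_cast Finset.card_union_le _ _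
  set K := 1 / minAngle (latticeHull (ones f))
  have hK0 : 0 ≤ K := one_div_nonneg.2 (minAngle_nonneg _)
  have hmain := card_add_card_le hS ones_subset_box hK0
    (fun u v w hw hv hc => dot_le_inv_minAngle_mul_cross hw hv hc) O Z
    (fun m hm => by
      obtain ⟨x, hx, rfl⟩ := Finset.mem_image.1 hm
      obtain ⟨-, hx, hfx⟩ := Finset.mem_filter.1 hx
      exact ⟨toLattice_mem_ones.2 hfx, isSeparated_erase_of_essential hx hfx⟩)
    (fun m hm => by
      obtain ⟨x, hx, rfl⟩ := Finset.mem_image.1 hm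
      obtain ⟨-, hx, hfx⟩ := Finset.mem_filter.1 hx
      exact ⟨isAddable_of_essential hx hfx, isSeparated_ones hf hfx⟩)
  have hn : ∑ e ∈ edgeFinset (ones f), (latticeLength e.1 e.2 : ℝ) ≤ 4 * n := by
    exact_mod_cast sum_latticeLength_le ones_subset_box
  have hP := sum_latticeLength_le_perimeter hS
  have h0 : (0 : ℝ) ≤ ∑ e ∈ edgeFinset (ones f), (latticeLength e.1 e.2 : ℝ) :=
    Finset.sum_nonneg fun _ _ => Nat.cast_nonneg _
  have m1 := min_le_left (n : ℝ) (2 * K)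
  have m2 := min_le_right (n : ℝ) (2 * K)
  rcases min_choice (n : ℝ) (perimeter (latticeHull (ones f)) + K) with h | h <;> rw [h] <;>
    linarith

end

end KThreshold

theorem theorem2 :
    ∃ C : ℝ, 0 < C ∧ ∀ n : ℕ, 2 ≤ n →
      ∀ f ∈ KThreshold.thresholdClassAll 2 n,
        0 < MeasureTheory.volume (KThreshold.hull f) →
          ((KThreshold.essentialPoints f (KThreshold.thresholdClassAll 2 n)).ncard : ℝ) ≤
            C * min (n : ℝ)
              (KThreshold.perimeter (KThreshold.hull f)
                + 1 / KThreshold.minAngle (KThreshold.hull f)) :=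
  ⟨28, by norm_num, fun _ _ _ hf hvol => KThreshold.ncard_essentialPoints_le hf hvol⟩
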